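/- **Notation.** Let $\mathcal H$ be a complex Hilbert space. Products, powers and commutators of unbounded operators are taken on their natural domains: $D(AB)=\{\psi\in D(B): B\psi\in D(A)\}$, $A^0=\mathbb 1$, $A^{m+1}=A\,A^m$, $[A,B]=AB-BA$ with $D([A,B])=D(AB)\cap D(BA)$. Write $C^\infty(H_0)=\bigcap_{m\ge1}D(H_0^m)$. A conjugation is a map $J:\mathcal H\to\mathcal H$ with $\langle J\varphi,J\psi\rangle=\langle\psi,\varphi\rangle$ and $J^2=\mathbb 1$. A family $(B(t))_{t\in\mathbb R}$ of operators *satisfies the relative bounds* if for every $m\in\mathbb N_0$ one has $D(H_0^{m+1})\subseteq D(H_0^mB(t))$ for all $t$, and for every compact interval $I$ there are $a_m,b_m\ge0$ with $\|H_0^mB(t)\psi\|\le a_m\|H_0^{m+1}\psi\|+b_m\|\psi\|$ for all $\psi\in D(H_0^{m+1})$, $t\in I$. The *band condition with range $K$* says: there are $\alpha_j\le\beta_j\le\alpha_{j+1}$ ($j\in\mathbb Z$) with $\sigma(H_0)\subseteq\bigcup_j[\alpha_j,\beta_j]$ and $E_0([\alpha_i,\beta_i])H(t)E_0([\alpha_j,\beta_j])=0$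 for all $t$ whenever $|i-j|>K$, where $E_0$ is the spectral measure of $H_0$. **Hypotheses.** Let $H_0$ be a positive ($\langle\psi,H_0\psi\rangle\ge0$) self-adjoint operator on $\mathcal H$ and $(H(t))_{t\in\mathbb R}$ a family of operators such that: 1. every $H(t)$ is self-adjoint with $D(H(t))=D(H_0)$; 2. $(H(t))$ satisfies the relative bounds; 3. there is a family $(H'(t))$ satisfying the relative bounds such that, for every $m\in\mathbb N_0$ and $\psi\in D(H_0^{m+1})$, the map $t\mapsto H_0^mH(t)\psi$ is continuously differentiable with derivative $H_0^mH'(t)\psi$; 4. $H(t+1)=H(t)$ for all $t$; 5. for every $m\in\mathbb N_0$ and compact interval $I$ there are $\tilde a_m,\tilde b_m\ge0$ with $\|[H_0^m,H(t)]\psi\|\le\tilde a_m\|H_0^m\psi\|+\tilde b_m\|\psi\|$ for all $t\in I$ and all $\psi\in D([H_0^m,H(t)])$ (this domain is $D(H_0^{m+1})$); 6. the band condition holds with some range $K\ge0$; 7. there is a conjugation $J$ with $JH(t)\subseteq H(-t)J$ for all $t$. For $T>0$ put $H^{(T)}(t)=H(t/T)$. **Conclusion.** For every $T>0$ there is a unitary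 propagator $(U^{(T)}(t,s))_{t,s\in\mathbb R}$ (jointly strongly continuous, $U^{(T)}(t,t)=\mathbb 1$, $U^{(T)}(t,r)=U^{(T)}(t,s)U^{(T)}(s,r)$) such that for all $s\in\mathbb R$ and $\psi_0\in D(H_0)$ the function $\psi(t)=U^{(T)}(t,s)\psi_0$ is the unique solution of $$\psi'(t)=-\mathrm i\,H^{(T)}(t)\psi(t)\quad(t\in\mathbb R),\qquad \psi(s)=\psi_0,$$ among the $D(H_0)$-valued functions that are continuous for the graph norm of $H_0$ and continuously differentiable in $\mathcal H$; and it is the only family of unitaries with this property. Moreover, with $U^{(T)}(t)=U^{(T)}(t,0)$ (so $U^{(T)}(0)=\mathbb 1$), the following conditions (Assumption A) hold, for all $t\in\mathbb R$, $T>0$ and $\psi\in C^\infty(H_0)$: - (A1) $C^\infty(H_0)\subseteq D(H(t))$ and $H(t)C^\infty(H_0)\subseteq C^\infty(H_0)$; - (A2) $U^{(T)}(t)C^\infty(H_0)\subseteq C^\infty(H_0)$; - (A3) $t\mapsto H_0^mH(t)\psi$ is continuous for every $m\in\mathbb N_0$; - (A4) for every $m\in\mathbb N_0$, $t\mapsto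 H_0^mU^{(T)}(t)\psi$ is differentiable with derivative $-\mathrm i\,H_0^mH^{(T)}(t)U^{(T)}(t)\psi$; - (A5) for every $m\in\mathbb N_0$ and compact interval $I$ there are $k_m\in\mathbb N_0$, $a_m,b_m\ge0$ with $\|H_0^mH(t)\psi\|\le a_m\|H_0^{m+k_m}\psi\|+b_m\|\psi\|$ for all $t\in I$, $\psi\in C^\infty(H_0)$; - (A6) for every $m\in\mathbb N$ and compact interval $I$ there are $k_m'\in\mathbb N_0$ and, for each $T>0$, constants $a_m'^{(T)},b_m'^{(T)}\ge0$ with $\|H_0^mU^{(T)}(t)\psi\|\le a_m'^{(T)}\|H_0^{m+k_m'}\psi\|+b_m'^{(T)}\|\psi\|$ for all $t\in I$, $\psi\in C^\infty(H_0)$, and $a_m'^{(T)}=\mathcal O(1)$, $b_m'^{(T)}=\mathcal O(1)$ as $T\to0$; - (A7) $H(t+1)\psi=H(t)\psi$; - (A8) the band condition holds with some range $K>0$; - (A9) there is a conjugation $J$ with $JH(t)\subseteq H(-t)J$ for all $t$. -/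

import Mathlib

open Filter Topology MeasureTheory

noncomputable section

namespace ConstDom

variable {ℋ : Type*} [NormedAddCommGroup ℋ] [InnerProductSpace ℂ ℋ]

/-! ## Unbounded operators: composition, powers, commutators -/

/-- The product `A B` of two unbounded operators on its natural domain
`{ψ ∈ D(B) | B ψ ∈ D(A)}`. -/
def pcomp (A B : ℋ →ₗ.[ℂ] ℋ) : ℋ →ₗ.[ℂ] ℋ :=
  A.comp (B.domRestrict ((A.domain.comap B.toFun).map B.domain.subtype)) (by
    rintro ⟨x, hx⟩
    obtain ⟨⟨y, hyA, rfl⟩, hB⟩ := hx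
    exact hyA)

/-- The natural powers `A ^ m` of an unbounded operator, with `A ^ 0 = 1` defined everywhere. -/
def ppow (A : ℋ →ₗ.[ℂ] ℋ) : ℕ → (ℋ →ₗ.[ℂ] ℋ)
  | 0 => LinearMap.id.toPMap ⊤
  | m + 1 => pcomp A (ppow A m)

/-- The commutator `[A, B] = A B - B A` on its natural domain `D(A B) ∩ D(B A)`. -/
def pcomm (A B : ℋ →ₗ.[ℂ] ℋ) : ℋ →ₗ.[ℂ] ℋ := pcomp A B - pcomp B A

open Classical in
/-- The value `A ψ`, extended by `0` to vectors `ψ` outside the domain of `A`. -/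
def ap (A : ℋ →ₗ.[ℂ] ℋ) (ψ : ℋ) : ℋ := if h : ψ ∈ A.domain then A ⟨ψ, h⟩ else 0

theorem ap_of_mem (A : ℋ →ₗ.[ℂ] ℋ) {ψ : ℋ} (h : ψ ∈ A.domain) : ap A ψ = A ⟨ψ, h⟩ := dif_pos h

theorem mem_pcomp_domain (A B : ℋ →ₗ.[ℂ] ℋ) (ψ : ℋ) :
    ψ ∈ (pcomp A B).domain ↔ ∃ h : ψ ∈ B.domain, B ⟨ψ, h⟩ ∈ A.domain := by
  constructor
  · rintro ⟨⟨y, hyA, rfl⟩, hB⟩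
    exact ⟨y.2, hyA⟩
  · rintro ⟨h, hA⟩
    exact ⟨⟨⟨ψ, h⟩, hA, rfl⟩, h⟩

theorem pcomp_apply (A B : ℋ →ₗ.[ℂ] ℋ) {ψ : ℋ} (h : ψ ∈ B.domain)
    (hA : B ⟨ψ, h⟩ ∈ A.domain) (hAB : ψ ∈ (pcomp A B).domain) :
    pcomp A B ⟨ψ, hAB⟩ = A ⟨B ⟨ψ, h⟩, hA⟩ := rfl

/-- The smooth vectors `C^∞(A) = ⋂ₘ D(A ^ m)`. -/
def cinfty (A : ℋ →ₗ.[ℂ] ℋ) : Submodule ℂ ℋ := ⨅ m : ℕ, (ppow A m).domain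

/-- The spectrum of an unbounded operator: the complement of the set of `z` for which `A - z`
is a bijection from `D(A)` onto the space with bounded inverse. -/
def pspectrum (A : ℋ →ₗ.[ℂ] ℋ) : Set ℂ :=
  {z | ¬ ∃ R : ℋ →L[ℂ] ℋ,
    (∀ ψ, ∃ h : R ψ ∈ A.domain, A ⟨R ψ, h⟩ - z • R ψ = ψ) ∧
    ∀ ψ : A.domain, R (A ψ - z • (ψ : ℋ)) = ψ}

/-- A conjugation: an anti-unitary involution. -/
structure IsConjugation (J : ℋ → ℋ) : Prop where
  inner_map : ∀ φ ψ, inner ℂ (J φ) (J ψ) = inner ℂ ψ φ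
  involutive : ∀ ψ, J (J ψ) = ψ

/-! ## The spectral measure of a self-adjoint operator -/

/-- A projection-valued measure on the Borel sets of `ℝ` (the values on other sets play no role):
orthogonal projections, normalised, multiplicative, and strongly countably additive. -/
structure PVM (ℋ : Type*) [NormedAddCommGroup ℋ] [InnerProductSpace ℂ ℋ] [CompleteSpace ℋ] where
  proj : Set ℝ → (ℋ →L[ℂ] ℋ)
  isStarProjection : ∀ s, MeasurableSet s → IsStarProjection (proj s)
  proj_univ : proj Set.univ = 1
  proj_inter : ∀ s t, MeasurableSet s → MeasurableSet t → proj (s ∩ t) = proj s * proj t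
  hasSum_iUnion : ∀ s : ℕ → Set ℝ, (∀ n, MeasurableSet (s n)) →
    Pairwise (Function.onFun Disjoint s) →
    ∀ ψ, HasSum (fun n => proj (s n) ψ) (proj (⋃ n, s n) ψ)

section
variable [CompleteSpace ℋ]

theorem PVM.inner_proj (E : PVM ℋ) {s : Set ℝ} (hs : MeasurableSet s) (ψ : ℋ) :
    inner ℂ ψ (E.proj s ψ) = ((‖E.proj s ψ‖ ^ 2 : ℝ) : ℂ) := by
  have h := E.isStarProjection s hs
  have h1 : E.proj s (E.proj s ψ) = E.proj s ψ :=
    DFunLike.congr_fun h.isIdempotentElem.eq ψ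
  have h2 : ContinuousLinearMap.adjoint (E.proj s) = E.proj s := h.isSelfAdjoint.star_eq
  calc inner ℂ ψ (E.proj s ψ) = inner ℂ ψ (E.proj s (E.proj s ψ)) := by rw [h1]
    _ = inner ℂ (ContinuousLinearMap.adjoint (E.proj s) ψ) (E.proj s ψ) := by
        rw [ContinuousLinearMap.adjoint_inner_left]
    _ = inner ℂ (E.proj s ψ) (E.proj s ψ) := by rw [h2]
    _ = _ := by rw [inner_self_eq_norm_sq_to_K]; push_cast; rfl

theorem PVM.hasSum_norm_sq (E : PVM ℋ) (s : ℕ → Set ℝ) (hs : ∀ n, MeasurableSet (s n))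
    (hd : Pairwise (Function.onFun Disjoint s)) (ψ : ℋ) :
    HasSum (fun n => ‖E.proj (s n) ψ‖ ^ 2) (‖E.proj (⋃ n, s n) ψ‖ ^ 2) := by
  have h := (E.hasSum_iUnion s hs hd ψ).mapL (innerSL ℂ ψ)
  simp only [innerSL_apply_apply] at h
  rw [E.inner_proj (MeasurableSet.iUnion hs)] at h
  simp only [E.inner_proj (hs _)] at h
  exact_mod_cast h

theorem PVM.proj_empty (E : PVM ℋ) (ψ : ℋ) : E.proj ∅ ψ = 0 := by
  have h := E.hasSum_iUnion (fun _ => ∅) (fun _ => MeasurableSet.empty)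
    (fun _ _ _ => disjoint_bot_left) ψ
  exact tendsto_nhds_unique tendsto_const_nhds h.summable.tendsto_atTop_zero

/-- The scalar spectral measure `s ↦ ⟨ψ, E(s) ψ⟩ = ‖E(s) ψ‖²`. -/
def PVM.measure (E : PVM ℋ) (ψ : ℋ) : Measure ℝ :=
  Measure.ofMeasurable (fun s _ => ENNReal.ofReal (‖E.proj s ψ‖ ^ 2))
    (by simp [E.proj_empty]) (by
      intro s hs hd
      have h := E.hasSum_norm_sq s hs hd ψ
      rw [← h.tsum_eq]
      exact ENNReal.ofReal_tsum_of_nonneg (fun n => sq_nonneg _) h.summable)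

/-- `E` is the spectral measure of `A`, i.e. `A = ∫ x dE(x)`: the domain of `A` consists of the `ψ`
with `∫ x² d⟨ψ, E(x) ψ⟩ < ∞`, and `⟨ψ, A ψ⟩ = ∫ x d⟨ψ, E(x) ψ⟩` there. -/
structure PVM.IsSpectralMeasure (E : PVM ℋ) (A : ℋ →ₗ.[ℂ] ℋ) : Prop where
  mem_domain_iff : ∀ ψ, ψ ∈ A.domain ↔ Integrable (fun x : ℝ => x ^ 2) (E.measure ψ)
  inner_apply : ∀ ψ : A.domain,
    inner ℂ (ψ : ℋ) (A ψ) = ((∫ x, x ∂(E.measure (ψ : ℋ)) : ℝ) : ℂ)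

/-- The band condition with range `K`: the spectrum of `H₀` is covered by intervals
`[α_j, β_j]`, `α_j ≤ β_j ≤ α_{j+1}`, and `E₀([α_i, β_i]) H(t) E₀([α_j, β_j])` is (everywhere
defined and) zero if `|i - j| > K`. -/
def BandCondition (H₀ : ℋ →ₗ.[ℂ] ℋ) (H : ℝ → (ℋ →ₗ.[ℂ] ℋ)) (K : ℝ) : Prop :=
  ∃ α β : ℤ → ℝ, (∀ j, α j ≤ β j ∧ β j ≤ α (j + 1)) ∧
    pspectrum H₀ ⊆ ⋃ j, Complex.ofReal '' Set.Icc (α j) (β j) ∧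
    ∃ E₀ : PVM ℋ, E₀.IsSpectralMeasure H₀ ∧
      ∀ i j : ℤ, K < |((i - j : ℤ) : ℝ)| → ∀ (t : ℝ) (ψ : ℋ),
        ∃ h : E₀.proj (Set.Icc (α j) (β j)) ψ ∈ (H t).domain,
          E₀.proj (Set.Icc (α i) (β i)) (H t ⟨_, h⟩) = 0

end

/-- `J H(t) ⊆ H(-t) J` for all `t`, for some conjugation `J`. -/
def ConjugationCondition (H : ℝ → (ℋ →ₗ.[ℂ] ℋ)) : Prop :=
  ∃ J : ℋ → ℋ, IsConjugation J ∧ ∀ (t : ℝ) (ψ : (H t).domain),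
    ∃ h : J (ψ : ℋ) ∈ (H (-t)).domain, H (-t) ⟨J (ψ : ℋ), h⟩ = J (H t ψ)

/-! ## Assumptions on the Hamiltonian -/

/-- For every `m`, `H₀ ^ m B(t)` is `H₀ ^ (m + 1)`-bounded, uniformly for `t` in compact
intervals. -/
def RelBounds (H₀ : ℋ →ₗ.[ℂ] ℋ) (B : ℝ → (ℋ →ₗ.[ℂ] ℋ)) : Prop :=
  ∀ m : ℕ,
    (∀ t, (ppow H₀ (m + 1)).domain ≤ (pcomp (ppow H₀ m) (B t)).domain) ∧
    ∀ c d : ℝ, ∃ a b : ℝ, 0 ≤ a ∧ 0 ≤ b ∧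
      ∀ t ∈ Set.Icc c d, ∀ ψ ∈ (ppow H₀ (m + 1)).domain,
        ‖ap (pcomp (ppow H₀ m) (B t)) ψ‖ ≤ a * ‖ap (ppow H₀ (m + 1)) ψ‖ + b * ‖ψ‖

/-- The assumptions on the `1`-periodic Hamiltonian `H(t)` with constant domain and on the positive
reference operator `H₀`. The commutator bound is required on the natural domain of the commutator
(which is `D(H₀ ^ (m + 1))`, by the other assumptions). -/
structure HamiltonianAssumptions [CompleteSpace ℋ]
    (H₀ : ℋ →ₗ.[ℂ] ℋ) (H : ℝ → (ℋ →ₗ.[ℂ] ℋ)) : Prop where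
  selfAdjoint₀ : IsSelfAdjoint H₀
  positive₀ : ∀ ψ : H₀.domain, 0 ≤ (inner ℂ (ψ : ℋ) (H₀ ψ)).re
  selfAdjoint : ∀ t, IsSelfAdjoint (H t)
  domain_eq : ∀ t, (H t).domain = H₀.domain
  bound : RelBounds H₀ H
  diff : ∃ H' : ℝ → (ℋ →ₗ.[ℂ] ℋ), RelBounds H₀ H' ∧
    ∀ m : ℕ, ∀ ψ ∈ (ppow H₀ (m + 1)).domain,
      (∀ t, HasDerivAt (fun s => ap (pcomp (ppow H₀ m) (H s)) ψ)
        (ap (pcomp (ppow H₀ m) (H' t)) ψ) t) ∧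
      Continuous (fun t => ap (pcomp (ppow H₀ m) (H' t)) ψ)
  periodic : ∀ t, H (t + 1) = H t
  commutator : ∀ (m : ℕ) (c d : ℝ), ∃ a b : ℝ, 0 ≤ a ∧ 0 ≤ b ∧
    ∀ t ∈ Set.Icc c d, ∀ ψ ∈ (pcomm (ppow H₀ m) (H t)).domain,
      ‖ap (pcomm (ppow H₀ m) (H t)) ψ‖ ≤ a * ‖ap (ppow H₀ m) ψ‖ + b * ‖ψ‖
  band : ∃ K : ℝ, 0 ≤ K ∧ BandCondition H₀ H K
  conj : ConjugationCondition H

/-! ## The Schrödinger equation -/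

/-- The rescaled Hamiltonian `H^(T)(t) = H(t / T)`. -/
def rescale (H : ℝ → (ℋ →ₗ.[ℂ] ℋ)) (T : ℝ) : ℝ → (ℋ →ₗ.[ℂ] ℋ) := fun t => H (t / T)

/-- `φ` solves `φ'(t) = -i H(t) φ(t)` for all `t ∈ ℝ`, `φ(s) = ψ₀`; it is `D(H₀)`-valued, continuous
for the graph norm of `H₀`, and continuously differentiable in the Hilbert space. -/
structure IsSolution (H₀ : ℋ →ₗ.[ℂ] ℋ) (H : ℝ → (ℋ →ₗ.[ℂ] ℋ)) (s : ℝ) (ψ₀ : ℋ)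
    (φ : ℝ → ℋ) : Prop where
  initial : φ s = ψ₀
  mem_domain₀ : ∀ t, φ t ∈ H₀.domain
  mem_domain : ∀ t, φ t ∈ (H t).domain
  continuous_graph : Continuous (fun t => (φ t, ap H₀ (φ t)))
  contDiff : ContDiff ℝ 1 φ
  hasDerivAt : ∀ t, HasDerivAt φ (-Complex.I • ap (H t) (φ t)) t

section
variable [CompleteSpace ℋ]

/-- A unitary propagator: `U(t,t) = 1`, `U(t,r) = U(t,s) U(s,r)`, jointly strongly continuous. -/
structure IsUnitaryPropagator (U : ℝ → ℝ → unitary (ℋ →L[ℂ] ℋ)) : Prop where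
  refl : ∀ t, U t t = 1
  comp : ∀ t s r, U t r = U t s * U s r
  continuous : ∀ ψ : ℋ, Continuous (fun p : ℝ × ℝ => (U p.1 p.2 : ℋ →L[ℂ] ℋ) ψ)

/-- For all `s` and all `ψ₀ ∈ D(H₀)`, `t ↦ U(t,s) ψ₀` is the unique solution of the Schrödinger
equation for `H(t)` with value `ψ₀` at time `s`. -/
def SolvesSchrodinger (H₀ : ℋ →ₗ.[ℂ] ℋ) (H : ℝ → (ℋ →ₗ.[ℂ] ℋ))
    (U : ℝ → ℝ → unitary (ℋ →L[ℂ] ℋ)) : Prop :=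
  ∀ s : ℝ, ∀ ψ₀ ∈ H₀.domain,
    IsSolution H₀ H s ψ₀ (fun t => (U t s : ℋ →L[ℂ] ℋ) ψ₀) ∧
    ∀ φ, IsSolution H₀ H s ψ₀ φ → φ = fun t => (U t s : ℋ →L[ℂ] ℋ) ψ₀

/-! ## The general framework -/

/-- The conditions on `H₀`, `H(t)` and the unitaries `U^(T)(t)`, `T > 0`, under which effective
Hamiltonians and the Floquet-Magnus expansion are defined and compared with the dynamics. -/
structure GeneralAssumptions (H₀ : ℋ →ₗ.[ℂ] ℋ) (H : ℝ → (ℋ →ₗ.[ℂ] ℋ))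
    (U : ℝ → ℝ → unitary (ℋ →L[ℂ] ℋ)) : Prop where
  selfAdjoint₀ : IsSelfAdjoint H₀
  U_zero : ∀ T > 0, U T 0 = 1
  H_cinfty : ∀ t, ∀ ψ ∈ cinfty H₀, ∃ h : ψ ∈ (H t).domain, H t ⟨ψ, h⟩ ∈ cinfty H₀
  U_cinfty : ∀ T > 0, ∀ t, ∀ ψ ∈ cinfty H₀, (U T t : ℋ →L[ℂ] ℋ) ψ ∈ cinfty H₀
  H_cont : ∀ m : ℕ, ∀ ψ ∈ cinfty H₀, Continuous (fun t => ap (pcomp (ppow H₀ m) (H t)) ψ)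
  U_diff : ∀ m : ℕ, ∀ T > 0, ∀ ψ ∈ cinfty H₀, ∀ t,
    HasDerivAt (fun s => ap (ppow H₀ m) ((U T s : ℋ →L[ℂ] ℋ) ψ))
      (-Complex.I • ap (pcomp (ppow H₀ m) (rescale H T t)) ((U T t : ℋ →L[ℂ] ℋ) ψ)) t
  H_bound : ∀ (m : ℕ) (c d : ℝ), ∃ (k : ℕ) (a b : ℝ), 0 ≤ a ∧ 0 ≤ b ∧
    ∀ t ∈ Set.Icc c d, ∀ ψ ∈ cinfty H₀,
      ‖ap (pcomp (ppow H₀ m) (H t)) ψ‖ ≤ a * ‖ap (ppow H₀ (m + k)) ψ‖ + b * ‖ψ‖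
  U_bound : ∀ m : ℕ, 1 ≤ m → ∀ c d : ℝ, ∃ (k : ℕ) (a b : ℝ → ℝ),
    (∀ T > 0, 0 ≤ a T ∧ 0 ≤ b T ∧ ∀ t ∈ Set.Icc c d, ∀ ψ ∈ cinfty H₀,
      ‖ap (ppow H₀ m) ((U T t : ℋ →L[ℂ] ℋ) ψ)‖ ≤
        a T * ‖ap (ppow H₀ (m + k)) ψ‖ + b T * ‖ψ‖) ∧
    a =O[𝓝[>] 0] (fun _ => (1 : ℝ)) ∧ b =O[𝓝[>] 0] (fun _ => (1 : ℝ))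
  H_periodic : ∀ t, ∀ ψ ∈ cinfty H₀, ap (H (t + 1)) ψ = ap (H t) ψ
  band : ∃ K : ℝ, 0 < K ∧ BandCondition H₀ H K
  conj : ConjugationCondition H

end

end ConstDom

end

/-!
The resolvent `S = (H₀ + 1)⁻¹` turns the scale of domains `D(H₀ ^ m)` into the ranges of `S ^ m`,
and the Hamiltonian into the bounded operators `h m t = S ^ (-m) H(t) S ^ (m + 1)`, which are norm
continuous in time, uniformly bounded by periodicity, and satisfy
`‖h m t x - h 0 t x‖ ≤ c m * ‖S x‖` because of the commutator bounds (`HamiltonianAssumptions.exists_isScaleGenerator`).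

With the contractions `R = (1 + ε S⁻¹)⁻¹`, which commute with `S`, the bounded operators
`R H(t) R` generate evolutions on every space of the scale, by the linear theory of differential equations
(`exists_hasDerivAt_mul`). On the `m`-th space the generator `S ^ (-m) R H(t) R S ^ m` is
symmetric up to an operator of norm at most `c m`, whatever `ε` is. An energy estimate, which only
sees the symmetric part of `-i` times the generator (`norm_le_exp_of_abs_re_inner_deriv_le`),
therefore bounds the evolutions by `exp (c m * |t - s|)`, and, since the generators converge in
norm with rate `ε` when restricted to the space two steps further up in the scale, shows that the
evolutions converge strongly, locally uniformly in time, on all spaces at once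
(`IsScaleGenerator.exists_isScaleEvolution`). The limit solves the Schrödinger equation. Symmetry
of `H(t)` makes solutions unique and norm preserving, and uniqueness gives the cocycle property,
hence unitarity (`exists_isUnitaryPropagator`).

The bounds `exp (c m * |t - s|)` are not affected by a rescaling of time, so that they are uniform
in `T`; to express them through `H₀ ^ m` in place of `(H₀ + 1) ^ m`, one uses that the polynomials
`(1 - X) ^ m` and `X ^ m` are coprime (`IsResolvent.exists_norm_le`).
-/

namespace ConstDom

/-! ### Energy estimate -/

theorem norm_le_exp_of_inner_deriv_le_right {E : Type*} [NormedAddCommGroup E]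
    [InnerProductSpace ℝ E] {φ φ' : ℝ → E} {c F s τ : ℝ} (hc : 0 ≤ c) (hF : 0 ≤ F)
    (hφ : ∀ t, HasDerivAt φ (φ' t) t)
    (hb : ∀ t ∈ Set.Icc s (s + τ), inner ℝ (φ t) (φ' t) ≤ c * ‖φ t‖ ^ 2 + F * ‖φ t‖)
    {t : ℝ} (ht : t ∈ Set.Icc s (s + τ)) :
    ‖φ t‖ ≤ Real.exp (c * (t - s)) * (‖φ s‖ + F * (t - s)) := by
  -- The norm is regularised to `√(‖φ‖² + η²)`, which is differentiable also where `φ` vanishes.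
  have key : ∀ η : ℝ, 0 < η →
      ‖φ t‖ ≤ Real.exp (c * (t - s)) * (‖φ s‖ + η + F * (t - s)) := by
    intro η hη
    set f : ℝ → ℝ := fun t => √(‖φ t‖ ^ 2 + η ^ 2) with hf
    have hpos : ∀ t, 0 < ‖φ t‖ ^ 2 + η ^ 2 := fun t => by positivity
    have hfpos : ∀ t, 0 < f t := fun t => Real.sqrt_pos.2 (hpos t)
    have hfle : ∀ t, ‖φ t‖ ≤ f t := fun t => by
      refine Real.le_sqrt_of_sq_le ?_
      have := sq_nonneg η
      linarith
    have hfd : ∀ t, HasDerivAt f (inner ℝ (φ t) (φ' t) / f t) t := by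
      intro t
      have h := ((hφ t).norm_sq.add_const (η ^ 2)).sqrt (hpos t).ne'
      convert h using 1
      have := (hfpos t).ne'
      change _ = _ / (2 * f t)
      field_simp
    set g : ℝ → ℝ := fun t => Real.exp (-(c * (t - s))) * f t - F * (t - s) with hg
    have hgd : ∀ t, HasDerivAt g (Real.exp (-(c * (t - s))) *
        (inner ℝ (φ t) (φ' t) / f t - c * f t) - F) t := by
      intro t
      have h1 : HasDerivAt (fun t : ℝ => t - s) 1 t := (hasDerivAt_id t).sub_const s
      have h := (((h1.const_mul c).neg.exp).mul (hfd t)).sub (h1.const_mul F)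
      exact h.congr_deriv (by simp only [mul_one, Pi.neg_apply]; ring)
    have hanti : AntitoneOn g (Set.Icc s (s + τ)) := by
      refine antitoneOn_of_deriv_nonpos (convex_Icc _ _)
        (fun t _ => (hgd t).continuousAt.continuousWithinAt)
        (fun t _ => (hgd t).differentiableAt.differentiableWithinAt) ?_
      intro t ht
      rw [(hgd t).deriv]
      have ht' := interior_subset ht
      have h1 : inner ℝ (φ t) (φ' t) / f t - c * f t ≤ F := by
        have h2 : inner ℝ (φ t) (φ' t) ≤ (F + c * f t) * f t := by
          refine (hb t ht').trans ?_
          have h3 := hfle t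
          have h4 : ‖φ t‖ ^ 2 ≤ f t * f t := by rw [sq]; gcongr
          nlinarith [mul_le_mul_of_nonneg_left h3 hF, mul_le_mul_of_nonneg_left h4 hc]
        have := (div_le_iff₀ (hfpos t)).2 h2
        linarith
      have h2 : Real.exp (-(c * (t - s))) ≤ 1 := by
        rw [Real.exp_le_one_iff]
        have := mul_nonneg hc (sub_nonneg.2 ht'.1)
        linarith
      have h3 := mul_le_mul_of_nonneg_left h1 (Real.exp_pos (-(c * (t - s)))).le
      have h4 := mul_le_mul_of_nonneg_right h2 hF
      linarith
    have h1 := hanti (Set.left_mem_Icc.2 (ht.1.trans ht.2)) ht ht.1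
    have h2 : f s ≤ ‖φ s‖ + η := by
      refine Real.sqrt_le_iff.2 ⟨by positivity, ?_⟩
      nlinarith [mul_nonneg (norm_nonneg (φ s)) hη.le]
    have h3 : g s = f s := by simp [hg]
    have h4 : Real.exp (-(c * (t - s))) * f t ≤ ‖φ s‖ + η + F * (t - s) := by
      rw [h3] at h1
      change Real.exp (-(c * (t - s))) * f t - F * (t - s) ≤ f s at h1
      linarith
    calc ‖φ t‖ ≤ f t := hfle t
      _ = Real.exp (c * (t - s)) * (Real.exp (-(c * (t - s))) * f t) := by
          rw [← mul_assoc, ← Real.exp_add]; simp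
      _ ≤ _ := by gcongr
  refine le_of_forall_pos_le_add fun ε hε => ?_
  have h := key (ε / Real.exp (c * (t - s))) (by positivity)
  have h1 := (Real.exp_pos (c * (t - s))).ne'
  calc _ ≤ _ := h
    _ = _ := by field_simp; ring

theorem norm_le_exp_of_abs_inner_deriv_le {E : Type*} [NormedAddCommGroup E]
    [InnerProductSpace ℝ E] {φ φ' : ℝ → E} {c F s τ : ℝ} (hc : 0 ≤ c) (hF : 0 ≤ F)
    (hφ : ∀ t, HasDerivAt φ (φ' t) t)
    (hb : ∀ t, |t - s| ≤ τ → |inner ℝ (φ t) (φ' t)| ≤ c * ‖φ t‖ ^ 2 + F * ‖φ t‖)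
    {t : ℝ} (ht : |t - s| ≤ τ) :
    ‖φ t‖ ≤ Real.exp (c * |t - s|) * (‖φ s‖ + F * |t - s|) := by
  have habs : ∀ r ∈ Set.Icc s (s + τ), |r - s| ≤ τ := fun r hr => by
    rw [abs_le]; constructor <;> linarith [hr.1, hr.2]
  rcases le_total s t with h | h
  · rw [abs_of_nonneg (sub_nonneg.2 h)] at ht ⊢
    exact norm_le_exp_of_inner_deriv_le_right hc hF hφ
      (fun r hr => (le_abs_self _).trans (hb r (habs r hr))) ⟨h, by linarith⟩
  · rw [abs_of_nonpos (sub_nonpos.2 h)] at ht ⊢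
    -- Backward in time, the forward estimate applies to the reflected function.
    have hd : ∀ r, HasDerivAt (fun r => φ (2 * s - r)) (-φ' (2 * s - r)) r := fun r => by
      have := (hφ (2 * s - r)).scomp r ((hasDerivAt_id r).const_sub (2 * s))
      simpa [Function.comp_def] using this
    have := norm_le_exp_of_inner_deriv_le_right (s := s) (τ := τ) (t := 2 * s - t) hc hF hd
      (fun r hr => by
        rw [inner_neg_right]
        refine (neg_le_abs _).trans (hb _ ?_)
        have := habs r hr
        rwa [show 2 * s - r - s = -(r - s) by ring, abs_neg]) ⟨by linarith, by linarith⟩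
    simp only [sub_sub_cancel] at this
    rw [show 2 * s - s = s by ring, show 2 * s - t - s = -(t - s) by ring] at this
    exact this

/-- Energy estimate: if `|Re ⟨φ, φ'⟩| ≤ c ‖φ‖² + F ‖φ‖`, then `‖φ‖` grows at most as in Grönwall's
inequality. In contrast to the latter, no bound on `‖φ'‖` is needed, so that the skew-adjoint part
of a generator does not contribute. -/
theorem norm_le_exp_of_abs_re_inner_deriv_le {E : Type*} [NormedAddCommGroup E]
    [InnerProductSpace ℂ E] {φ φ' : ℝ → E} {c F s τ : ℝ} (hc : 0 ≤ c) (hF : 0 ≤ F)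
    (hφ : ∀ t, HasDerivAt φ (φ' t) t)
    (hb : ∀ t, |t - s| ≤ τ → |(inner ℂ (φ t) (φ' t)).re| ≤ c * ‖φ t‖ ^ 2 + F * ‖φ t‖)
    {t : ℝ} (ht : |t - s| ≤ τ) :
    ‖φ t‖ ≤ Real.exp (c * |t - s|) * (‖φ s‖ + F * |t - s|) := by
  let _ : InnerProductSpace ℝ E := InnerProductSpace.complexToReal
  exact norm_le_exp_of_abs_inner_deriv_le hc hF hφ hb ht

/-! ### Linear differential equations in a Banach algebra -/

theorem abs_integral_exp_mul_abs_le {k : ℝ} (hk : 0 < k) (s t : ℝ) :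
    |∫ r in s..t, Real.exp (k * |r - s|)| ≤ Real.exp (k * |t - s|) / k := by
  have main : ∀ σ : ℝ, |σ| = 1 → (∀ r ∈ Set.uIcc s t, |r - s| = σ * (r - s)) →
      |∫ r in s..t, Real.exp (k * |r - s|)| ≤ Real.exp (k * |t - s|) / k := by
    intro σ hσ h
    have hσ0 : σ ≠ 0 := by rintro rfl; simp at hσ
    have h1 : ∫ r in s..t, Real.exp (k * |r - s|) =
        ∫ r in s..t, Real.exp (k * (σ * (r - s))) :=
      intervalIntegral.integral_congr fun r hr => by simp only [h r hr]
    have h2 : ∀ r ∈ Set.uIcc s t, HasDerivAt (fun r => Real.exp (k * (σ * (r - s))) / (k * σ))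
        (Real.exp (k * (σ * (r - s)))) r := fun r _ => by
      have := (((((hasDerivAt_id r).sub_const s).const_mul σ).const_mul k).exp).div_const (k * σ)
      refine this.congr_deriv ?_
      simp only [id, mul_one]
      field_simp
    rw [h1, intervalIntegral.integral_eq_sub_of_hasDerivAt h2
      (Continuous.intervalIntegrable (by fun_prop) _ _), ← h t Set.right_mem_uIcc, ← sub_div,
      abs_div, abs_mul, hσ, abs_of_pos hk, mul_one]
    gcongr
    simp only [sub_self, mul_zero, Real.exp_zero]
    rw [abs_of_nonneg (sub_nonneg.2 (Real.one_le_exp (by positivity)))]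
    linarith
  rcases le_total s t with hst | hst
  · refine main 1 (by simp) fun r hr => ?_
    rw [Set.uIcc_of_le hst] at hr
    rw [one_mul, abs_of_nonneg (sub_nonneg.2 hr.1)]
  · refine main (-1) (by simp) fun r hr => ?_
    rw [Set.uIcc_of_ge hst] at hr
    rw [neg_one_mul, abs_of_nonpos (sub_nonpos.2 hr.2)]

/-- Global solvability of `X' = A(t) X` with a bounded continuous coefficient. The integral equation
is solved on the whole line at once, by the contraction principle in a space of functions of
exponential growth. -/
theorem exists_hasDerivAt_mul {𝔸 : Type*} [NormedRing 𝔸] [NormedAlgebra ℝ 𝔸] [CompleteSpace 𝔸]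
    {A : ℝ → 𝔸} (hA : Continuous A) {M : ℝ} (hM : ∀ t, ‖A t‖ ≤ M) (s : ℝ) :
    ∃ X : ℝ → 𝔸, X s = 1 ∧ ∀ t, HasDerivAt X (A t * X t) t := by
  set N : ℝ := |M| + 1 with hN
  have hN0 : 0 < N := by positivity
  have hAN : ∀ t, ‖A t‖ ≤ N := fun t => (hM t).trans (by linarith [le_abs_self M])
  -- The weight `w` makes the Picard map contracting with constant `1 / 2`.
  set w : ℝ → ℝ := fun t => Real.exp (2 * N * |t - s|) with hw
  have hw0 : ∀ t, 0 < w t := fun t => Real.exp_pos _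
  have hw1 : ∀ t, 1 ≤ w t := fun t => Real.one_le_exp (by positivity)
  have hwc : Continuous w := by fun_prop
  have hcont : ∀ u : BoundedContinuousFunction ℝ 𝔸, Continuous (fun r => A r * w r • u r) :=
    fun u => hA.mul (hwc.smul u.continuous)
  have hint : ∀ (u : BoundedContinuousFunction ℝ 𝔸) (t : ℝ),
      ‖∫ r in s..t, A r * w r • u r‖ ≤ ‖u‖ / 2 * w t := by
    intro u t
    have h1 : ‖∫ r in s..t, A r * w r • u r‖ ≤ |∫ r in s..t, N * ‖u‖ * w r| := by
      refine intervalIntegral.norm_integral_le_abs_of_norm_le (Eventually.of_forall fun r => ?_)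
        (Continuous.intervalIntegrable (by fun_prop) _ _)
      calc ‖A r * w r • u r‖ ≤ ‖A r‖ * ‖w r • u r‖ := norm_mul_le _ _
        _ = ‖A r‖ * (w r * ‖u r‖) := by
            rw [norm_smul, Real.norm_of_nonneg (hw0 r).le]
        _ ≤ N * (w r * ‖u‖) := by
            have := (hw0 r).le
            gcongr
            exacts [hAN r, u.norm_coe_le_norm r]
        _ = _ := by ring
    rw [intervalIntegral.integral_const_mul, abs_mul, abs_of_nonneg (by positivity)] at h1
    refine h1.trans ?_
    calc _ ≤ N * ‖u‖ * (w t / (2 * N)) := by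
          gcongr
          exact abs_integral_exp_mul_abs_le (by positivity) s t
      _ = _ := by field_simp
  let Γ : BoundedContinuousFunction ℝ 𝔸 → BoundedContinuousFunction ℝ 𝔸 := fun u =>
    BoundedContinuousFunction.ofNormedAddCommGroup
      (fun t => (w t)⁻¹ • (1 + ∫ r in s..t, A r * w r • u r))
      ((hwc.inv₀ fun t => (hw0 t).ne').smul (continuous_const.add
        (intervalIntegral.continuous_primitive
          (fun a b => (hcont u).intervalIntegrable a b) s)))
      (‖(1 : 𝔸)‖ + ‖u‖ / 2) (fun t => by
        rw [norm_smul, norm_inv, Real.norm_of_nonneg (hw0 t).le, inv_mul_le_iff₀ (hw0 t)]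
        refine (norm_add_le _ _).trans ?_
        nlinarith [hint u t, hw1 t, norm_nonneg (1 : 𝔸)])
  have hΓ : ∀ u t, Γ u t = (w t)⁻¹ • (1 + ∫ r in s..t, A r * w r • u r) := fun _ _ => rfl
  have hcontr : ContractingWith (1 / 2) Γ := by
    refine ⟨by norm_num, LipschitzWith.of_dist_le_mul fun u v => ?_⟩
    rw [BoundedContinuousFunction.dist_le (by positivity)]
    intro t
    have h1 : Γ u t - Γ v t = (w t)⁻¹ • ∫ r in s..t, A r * w r • (u - v) r := by
      rw [hΓ, hΓ, ← smul_sub, add_sub_add_left_eq_sub,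
        ← intervalIntegral.integral_sub ((hcont u).intervalIntegrable _ _)
          ((hcont v).intervalIntegrable _ _)]
      simp only [BoundedContinuousFunction.coe_sub, Pi.sub_apply, smul_sub, mul_sub]
    rw [dist_eq_norm, h1, norm_smul, norm_inv, Real.norm_of_nonneg (hw0 t).le,
      inv_mul_le_iff₀ (hw0 t), dist_eq_norm]
    refine (hint (u - v) t).trans (le_of_eq ?_)
    push_cast
    ring
  set u := ContractingWith.fixedPoint Γ hcontr
  have hu : Γ u = u := hcontr.fixedPoint_isFixedPt
  have hX : ∀ t, w t • u t = 1 + ∫ r in s..t, A r * w r • u r := fun t => by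
    conv_lhs => rw [← hu]
    rw [hΓ, smul_inv_smul₀ (hw0 t).ne']
  refine ⟨fun t => w t • u t, by simp [hX s], fun t => ?_⟩
  have := (intervalIntegral.integral_hasDerivAt_right ((hcont u).intervalIntegrable s t)
    ((hcont u).stronglyMeasurableAtFilter _ _) (hcont u).continuousAt).const_add 1
  exact this.congr_of_eventuallyEq (Eventually.of_forall hX)

/-! ### Strong limits of operator families -/

/-- Uniform convergence to zero on a dense set of vectors extends to all vectors, for uniformly
bounded families of operators. -/
theorem tendstoUniformlyOn_zero_of_dense {ι E : Type*} [NormedAddCommGroup E] [NormedSpace ℂ E]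
    {l : Filter ι} {B : ι → ℝ → (E →L[ℂ] E)} {I : Set ℝ} {C : ℝ}
    (hC : ∀ i, ∀ t ∈ I, ‖B i t‖ ≤ C) {D : Set E} (hD : Dense D)
    (h : ∀ x ∈ D, TendstoUniformlyOn (fun i t => B i t x) 0 l I) (x : E) :
    TendstoUniformlyOn (fun i t => B i t x) 0 l I := by
  rw [Metric.tendstoUniformlyOn_iff]
  intro ε hε
  have hC' : 0 < |C| + 1 := by positivity
  obtain ⟨y, hy, hxy⟩ := Metric.dense_iff.1 hD x (ε / (2 * (|C| + 1))) (by positivity)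
  have h1 := Metric.tendstoUniformlyOn_iff.1 (h y hxy) (ε / 2) (by positivity)
  filter_upwards [h1] with i hi t ht
  have h2 := hi t ht
  simp only [Pi.zero_apply, dist_zero_left] at h2 ⊢
  have h3 : ‖B i t (x - y)‖ < ε / 2 := by
    calc ‖B i t (x - y)‖ ≤ ‖B i t‖ * ‖x - y‖ := (B i t).le_opNorm _
      _ ≤ (|C| + 1) * ‖x - y‖ := by
          gcongr
          linarith [hC i t ht, le_abs_self C]
      _ < (|C| + 1) * (ε / (2 * (|C| + 1))) := by
          gcongr
          rw [← dist_eq_norm, dist_comm]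
          exact hy
      _ = ε / 2 := by field_simp
  calc ‖B i t x‖ = ‖B i t (x - y) + B i t y‖ := by rw [← map_add, sub_add_cancel]
    _ ≤ _ := norm_add_le _ _
    _ < ε := by linarith

theorem tendstoUniformlyOn_zero_of_norm_le {ι E : Type*} [SeminormedAddCommGroup E] {l : Filter ι}
    {f : ι → ℝ → E} {I : Set ℝ} {a : ι → ℝ} (ha : Tendsto a l (𝓝 0))
    (hf : ∀ i, ∀ t ∈ I, ‖f i t‖ ≤ a i) :
    TendstoUniformlyOn f 0 l I := by
  rw [Metric.tendstoUniformlyOn_iff]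
  intro ε hε
  filter_upwards [ha.eventually_lt_const hε] with i hi t ht
  simpa using (hf i t ht).trans_lt hi

end ConstDom

namespace ConstDom

/-! ### Bounded regularisations of a generator on a scale of spaces -/

section Scale
variable {ℋ : Type*} [NormedAddCommGroup ℋ] [InnerProductSpace ℂ ℋ]

/-- A time-dependent generator on the scale of spaces `ran (S ^ m)`, described by bounded operators.
With `Λ = S⁻¹`, the operator `h m t` stands for `Λ ^ m H(t) S ^ (m + 1)`, and the last condition
bounds the commutator `[Λ ^ m, H(t)]` by `Λ ^ m`. -/
structure IsScaleGenerator (S : ℋ →L[ℂ] ℋ) (h : ℕ → ℝ → (ℋ →L[ℂ] ℋ)) (M c : ℕ → ℝ) : Prop where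
  isPositive : S.IsPositive
  injective : Function.Injective S
  intertwine : ∀ m t x, S (h (m + 1) t x) = h m t (S x)
  symm : ∀ t x y, inner ℂ (S x) (h 0 t y) = inner ℂ (h 0 t x) (S y)
  continuous : ∀ m, Continuous (h m)
  norm_le : ∀ m t, ‖h m t‖ ≤ M m
  nonneg : ∀ m, 0 ≤ c m
  norm_sub_le : ∀ m t x, ‖h m t x - h 0 t x‖ ≤ c m * ‖S x‖

/-- `G = (S + ε)⁻¹`; then `S G = (1 + ε S⁻¹)⁻¹` is a symmetric contraction. -/
structure IsShiftedInverse (S : ℋ →L[ℂ] ℋ) (ε : ℝ) (G : ℋ →L[ℂ] ℋ) : Prop where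
  comm : ∀ x, S (G x) = G (S x)
  add : ∀ x, S (G x) + (ε : ℂ) • G x = x
  symm : ∀ x y, inner ℂ (G x) y = inner ℂ x (G y)
  norm_le : ∀ x, ‖S (G x)‖ ≤ ‖x‖

theorem exists_isShiftedInverse [CompleteSpace ℋ] {S : ℋ →L[ℂ] ℋ} (hS : S.IsPositive) {ε : ℝ}
    (hε : 0 < ε) :
    ∃ G, IsShiftedInverse S ε G := by
  have hnn : 0 ≤ S := (ContinuousLinearMap.nonneg_iff_isPositive S).2 hS
  have hu : IsUnit (S + algebraMap ℝ (ℋ →L[ℂ] ℋ) ε) := by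
    have h1 : (-ε) ∉ spectrum ℝ S := fun h => by
      have := spectrum_nonneg_of_nonneg hnn h
      linarith
    rw [spectrum.notMem_iff] at h1
    have h2 := h1.neg
    rwa [map_neg, neg_sub, sub_neg_eq_add] at h2
  obtain ⟨G, hG1, hG2⟩ := isUnit_iff_exists.1 hu
  have hadd : ∀ x, S (G x) + (ε : ℂ) • G x = x := fun x => by
    have := DFunLike.congr_fun hG1 x
    simpa [Algebra.algebraMap_eq_smul_one, add_mul] using this
  have hadd' : ∀ x, G (S x) + (ε : ℂ) • G x = x := fun x => by
    have := DFunLike.congr_fun hG2 x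
    simpa [Algebra.algebraMap_eq_smul_one, mul_add] using this
  have hsymm : ∀ x y, inner ℂ (S x) y = inner ℂ x (S y) := fun x y => hS.isSymmetric x y
  refine ⟨G, fun x => ?_, hadd, fun x y => ?_, fun x => ?_⟩
  · exact add_right_cancel ((hadd x).trans (hadd' x).symm)
  · conv_lhs => rw [← hadd y]
    conv_rhs => rw [← hadd x]
    rw [inner_add_left, inner_add_right, hsymm, inner_smul_left, inner_smul_right,
      Complex.conj_ofReal]
  · have h1 : 0 ≤ (inner ℂ (S (G x)) (G x)).re := hS.re_inner_nonneg_left (G x)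
    have h2 : ‖x‖ ^ 2 = ‖S (G x)‖ ^ 2 + 2 * (ε * (inner ℂ (S (G x)) (G x)).re)
        + ‖(ε : ℂ) • G x‖ ^ 2 := by
      conv_lhs => rw [← hadd x]
      rw [@norm_add_sq ℂ, inner_smul_right]
      simp
    refine le_of_sq_le_sq ?_ (norm_nonneg x)
    have := mul_nonneg hε.le h1
    have := sq_nonneg ‖(ε : ℂ) • G x‖
    linarith

variable {S : ℋ →L[ℂ] ℋ} {h : ℕ → ℝ → (ℋ →L[ℂ] ℋ)} {M c : ℕ → ℝ}

theorem IsShiftedInverse.norm_sub_le {ε : ℝ} {G : ℋ →L[ℂ] ℋ} (hG : IsShiftedInverse S ε G)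
    (hε : 0 < ε) (x : ℋ) : ‖S (G (S x)) - S x‖ ≤ ε * ‖x‖ := by
  have h1 : S (G (S x)) - S x = -((ε : ℂ) • S (G x)) := by
    conv_lhs => enter [2]; rw [← hG.add (S x)]
    rw [hG.comm x]
    abel
  rw [h1, norm_neg, norm_smul, Complex.norm_of_nonneg hε.le]
  gcongr
  exact hG.norm_le x

theorem IsScaleGenerator.inner_left (hS : IsScaleGenerator S h M c) (x y : ℋ) :
    inner ℂ (S x) y = inner ℂ x (S y) :=
  hS.isPositive.isSymmetric x y

theorem IsScaleGenerator.denseRange [CompleteSpace ℋ] (hS : IsScaleGenerator S h M c) :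
    DenseRange S := by
  have h1 : S.toLinearMap.rangeᗮ = ⊥ := by
    rw [Submodule.eq_bot_iff]
    intro y hy
    refine hS.injective ?_
    rw [map_zero]
    refine ext_inner_left ℂ fun x => ?_
    rw [inner_zero_right, ← hS.inner_left]
    exact hy _ ⟨x, rfl⟩
  have h2 := Submodule.dense_iff_topologicalClosure_eq_top.2
    ((Submodule.topologicalClosure_eq_top_iff).2 h1)
  exact h2

theorem IsScaleGenerator.inner_h_zero_symm (hS : IsScaleGenerator S h M c) {ε : ℝ} {G : ℋ →L[ℂ] ℋ}
    (hG : IsShiftedInverse S ε G) (t : ℝ) (x : ℋ) :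
    (inner ℂ x (-Complex.I • S (G (h 0 t (G x))))).re = 0 := by
  have h1 : inner ℂ x (S (G (h 0 t (G x)))) = inner ℂ (S (G (h 0 t (G x)))) x := by
    have e1 : inner ℂ x (S (G (h 0 t (G x)))) = inner ℂ (S (G x)) (h 0 t (G x)) := by
      rw [← hS.inner_left, ← hG.symm, ← hG.comm]
    have e2 : inner ℂ (S (G (h 0 t (G x)))) x = inner ℂ (h 0 t (G x)) (S (G x)) := by
      rw [hG.comm, hG.symm, hS.inner_left]
    rw [e1, e2, hS.symm]
  have h2 : (inner ℂ x (S (G (h 0 t (G x))))).im = 0 := by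
    rw [← Complex.conj_eq_iff_im, inner_conj_symm, ← h1]
  rw [inner_smul_right]
  simp [h2]

/-- The regularised generators are skew-symmetric up to an error bounded uniformly in `ε`. -/
theorem IsScaleGenerator.abs_inner_le (hS : IsScaleGenerator S h M c) {ε : ℝ} {G : ℋ →L[ℂ] ℋ}
    (hG : IsShiftedInverse S ε G) (m : ℕ) (t : ℝ) (x : ℋ) :
    |(inner ℂ x (-Complex.I • S (G (h m t (G x))))).re| ≤ c m * ‖x‖ ^ 2 := by
  have h1 : -Complex.I • S (G (h m t (G x))) = -Complex.I • S (G (h 0 t (G x))) +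
      -Complex.I • S (G (h m t (G x) - h 0 t (G x))) := by
    rw [← smul_add, ← map_add, ← map_add, add_sub_cancel]
  rw [h1, inner_add_right, Complex.add_re, hS.inner_h_zero_symm hG t x, zero_add]
  refine (Complex.abs_re_le_norm _).trans ((norm_inner_le_norm _ _).trans ?_)
  rw [norm_smul, norm_neg, Complex.norm_I, one_mul, sq, mul_left_comm]
  gcongr
  refine (hG.norm_le _).trans ((hS.norm_sub_le m t _).trans ?_)
  have := hS.nonneg m
  gcongr
  exact hG.norm_le x

/-- On `ran (S ^ 2)` the regularised generators converge in norm, with rate `ε`. -/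
theorem IsScaleGenerator.norm_regularised_sub_le (hS : IsScaleGenerator S h M c) {ε : ℝ}
    {G : ℋ →L[ℂ] ℋ} (hG : IsShiftedInverse S ε G) (hε : 0 < ε) (m : ℕ) (t : ℝ) (x : ℋ) :
    ‖S (G (h m t (G (S (S x))))) - h m t (S x)‖ ≤ ε * (M (m + 1) + M m) * ‖x‖ := by
  have h1 : S (G (h m t (G (S (S x))))) - h m t (S x) =
      (S (G (S (h (m + 1) t (S (G x))))) - S (h (m + 1) t (S (G x)))) +
        h m t (S (G (S x)) - S x) := by
    rw [map_sub, hS.intertwine]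
    rw [hG.comm (S x), ← hG.comm (S x), hG.comm x]
    abel
  have hM : ∀ m, 0 ≤ M m := fun m => (norm_nonneg _).trans (hS.norm_le m t)
  rw [h1]
  refine (norm_add_le _ _).trans ?_
  have e1 : ‖S (G (S (h (m + 1) t (S (G x))))) - S (h (m + 1) t (S (G x)))‖ ≤
      ε * (M (m + 1) * ‖x‖) := by
    refine (hG.norm_sub_le hε _).trans ?_
    gcongr
    refine ((h (m + 1) t).le_opNorm _).trans ?_
    have := hM (m + 1)
    gcongr
    exacts [hS.norm_le _ _, hG.norm_le x]
  have e2 : ‖h m t (S (G (S x)) - S x)‖ ≤ M m * (ε * ‖x‖) := by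
    refine ((h m t).le_opNorm _).trans ?_
    have := hM m
    gcongr
    exacts [hS.norm_le _ _, hG.norm_sub_le hε x]
  linarith

/-- The evolution of the regularised generator `R H(t) R`, where `R = S G`: with `Λ = S⁻¹`, the
operator `W m t` stands for `Λ ^ m U(t, s) S ^ m`, and its generator is
`Λ ^ m R H(t) R S ^ m = S G h m t G`. -/
structure IsRegularisedEvolution (S : ℋ →L[ℂ] ℋ) (h : ℕ → ℝ → (ℋ →L[ℂ] ℋ)) (G : ℋ →L[ℂ] ℋ) (s : ℝ)
    (W : ℕ → ℝ → (ℋ →L[ℂ] ℋ)) : Prop where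
  initial : ∀ m, W m s = 1
  hasDerivAt : ∀ m t x,
    HasDerivAt (fun t => W m t x) (-Complex.I • S (G (h m t (G (W m t x))))) t

theorem IsScaleGenerator.exists_isRegularisedEvolution [CompleteSpace ℋ]
    (hS : IsScaleGenerator S h M c) (G : ℋ →L[ℂ] ℋ) (s : ℝ) :
    ∃ W, IsRegularisedEvolution S h G s W := by
  have h1 : ∀ m, ∃ X : ℝ → (ℋ →L[ℂ] ℋ), X s = 1 ∧
      ∀ t, HasDerivAt X ((-Complex.I • (S * G * h m t * G)) * X t) t := by
    intro m
    have hc := hS.continuous m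
    refine exists_hasDerivAt_mul (M := ‖S * G‖ * M m * ‖G‖) (by fun_prop) (fun t => ?_) s
    rw [norm_smul, norm_neg, Complex.norm_I, one_mul]
    refine (norm_mul_le _ _).trans ?_
    gcongr
    refine (norm_mul_le _ _).trans ?_
    gcongr
    exact hS.norm_le m t
  choose W hW1 hW2 using h1
  refine ⟨W, hW1, fun m t x => ?_⟩
  have := ((ContinuousLinearMap.apply ℂ ℋ x).restrictScalars ℝ).hasFDerivAt.comp_hasDerivAt t
    (hW2 m t)
  exact this

namespace IsRegularisedEvolution

variable {ε s : ℝ} {G : ℋ →L[ℂ] ℋ} {W : ℕ → ℝ → (ℋ →L[ℂ] ℋ)}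

theorem norm_apply_le (hW : IsRegularisedEvolution S h G s W) (hS : IsScaleGenerator S h M c)
    (hG : IsShiftedInverse S ε G) (m : ℕ) (t : ℝ) (x : ℋ) :
    ‖W m t x‖ ≤ Real.exp (c m * |t - s|) * ‖x‖ := by
  have := norm_le_exp_of_abs_re_inner_deriv_le (F := 0) (τ := |t - s|) (hS.nonneg m) le_rfl
    (fun t => hW.hasDerivAt m t x)
    (fun r _ => by simpa only [zero_mul, add_zero] using hS.abs_inner_le hG m r (W m r x))
    (t := t) le_rfl
  simpa [hW.initial] using this

/-- Both sides solve the same equation, because `S` intertwines the generators. -/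
theorem intertwine (hW : IsRegularisedEvolution S h G s W) (hS : IsScaleGenerator S h M c)
    (hG : IsShiftedInverse S ε G) (m : ℕ) (t : ℝ) (x : ℋ) :
    S (W (m + 1) t x) = W m t (S x) := by
  have hd : ∀ r, HasDerivAt (fun r => S (W (m + 1) r x) - W m r (S x))
      (-Complex.I • S (G (h m r (G (S (W (m + 1) r x) - W m r (S x)))))) r := fun r => by
    have h1 := (S.restrictScalars ℝ).hasFDerivAt.comp_hasDerivAt r (hW.hasDerivAt (m + 1) r x)
    refine (h1.sub (hW.hasDerivAt m r (S x))).congr_deriv ?_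
    rw [ContinuousLinearMap.coe_restrictScalars', map_smul, hG.comm (h _ _ _), hS.intertwine,
      hG.comm (W _ _ _)]
    simp only [map_sub, smul_sub]
  have := norm_le_exp_of_abs_re_inner_deriv_le (F := 0) (τ := |t - s|) (hS.nonneg m) le_rfl hd
    (fun r _ => by simpa only [zero_mul, add_zero] using hS.abs_inner_le hG m r _) (t := t) le_rfl
  simp only [hW.initial, one_apply_eq_self, sub_self, norm_zero, zero_mul, add_zero,
    mul_zero, norm_le_zero_iff] at this
  exact sub_eq_zero.1 this

/-- Two regularised evolutions are close on `ran (S ^ 2)`: the difference solves the first equation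
up to the difference of the generators, which acts on `S ^ 2` times the bounded evolution on the
space two steps further up. -/
theorem norm_sub_le (hW : IsRegularisedEvolution S h G s W) (hS : IsScaleGenerator S h M c)
    (hG : IsShiftedInverse S ε G) (hε : 0 < ε) {ε' : ℝ} {G' : ℋ →L[ℂ] ℋ}
    {W' : ℕ → ℝ → (ℋ →L[ℂ] ℋ)} (hW' : IsRegularisedEvolution S h G' s W')
    (hG' : IsShiftedInverse S ε' G') (hε' : 0 < ε') (m : ℕ) {τ t : ℝ} (ht : |t - s| ≤ τ) (x : ℋ) :
    ‖W m t (S (S x)) - W' m t (S (S x))‖ ≤ (ε + ε') *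
      (Real.exp (c m * τ) * ((M (m + 1) + M m) * (Real.exp (c (m + 2) * τ) * ‖x‖) * τ)) := by
  have hM : ∀ m, 0 ≤ M m := fun m => (norm_nonneg _).trans (hS.norm_le m 0)
  have hτ : 0 ≤ τ := (abs_nonneg _).trans ht
  have hc := hS.nonneg
  set F := (ε + ε') * (M (m + 1) + M m) * (Real.exp (c (m + 2) * τ) * ‖x‖) with hF
  have hF0 : 0 ≤ F := by have := hM m; have := hM (m + 1); positivity
  have hd : ∀ r, HasDerivAt (fun r => W m r (S (S x)) - W' m r (S (S x)))
      (-Complex.I • S (G (h m r (G (W m r (S (S x)) - W' m r (S (S x)))))) +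
        -Complex.I • (S (G (h m r (G (W' m r (S (S x)))))) -
          S (G' (h m r (G' (W' m r (S (S x)))))))) r := fun r => by
    refine ((hW.hasDerivAt m r _).sub (hW'.hasDerivAt m r _)).congr_deriv ?_
    simp only [map_sub, smul_sub]
    abel
  have hb : ∀ r, |r - s| ≤ τ → ‖-Complex.I • (S (G (h m r (G (W' m r (S (S x)))))) -
      S (G' (h m r (G' (W' m r (S (S x)))))))‖ ≤ F := fun r hr => by
    rw [norm_smul, norm_neg, Complex.norm_I, one_mul, ← hW'.intertwine hS hG',
      ← hW'.intertwine hS hG']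
    set z := W' (m + 1 + 1) r x with hz
    have h1 := hS.norm_regularised_sub_le hG hε m r z
    have h2 := hS.norm_regularised_sub_le hG' hε' m r z
    have h3 : ‖z‖ ≤ Real.exp (c (m + 2) * τ) * ‖x‖ := by
      refine (hW'.norm_apply_le hS hG' (m + 2) r x).trans ?_
      have := hc (m + 2)
      gcongr
    calc _ ≤ ε * (M (m + 1) + M m) * ‖z‖ + ε' * (M (m + 1) + M m) * ‖z‖ := by
          rw [← sub_sub_sub_cancel_right _ _ (h m r (S z))]
          exact (_root_.norm_sub_le _ _).trans (add_le_add h1 h2)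
      _ = (ε + ε') * (M (m + 1) + M m) * ‖z‖ := by ring
      _ ≤ F := by
          have := hM m
          have := hM (m + 1)
          rw [hF]
          gcongr
  have := norm_le_exp_of_abs_re_inner_deriv_le (F := F) (τ := τ) (hc m) hF0 hd
    (fun r hr => by
      rw [inner_add_right, Complex.add_re]
      refine (abs_add_le _ _).trans (add_le_add (hS.abs_inner_le hG m r _) ?_)
      refine (Complex.abs_re_le_norm _).trans ((norm_inner_le_norm _ _).trans ?_)
      rw [mul_comm]
      gcongr
      exact hb r hr) ht
  simp only [hW.initial, hW'.initial, one_apply_eq_self, sub_self, norm_zero,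
    zero_add] at this
  refine this.trans ?_
  have := hc m
  calc _ ≤ Real.exp (c m * τ) * (F * τ) := by gcongr
    _ = _ := by rw [hF]; ring

end IsRegularisedEvolution

end Scale

end ConstDom

namespace ConstDom

/-! ### The evolution on the scale as a limit of regularised evolutions -/

section Scale
variable {ℋ : Type*} [NormedAddCommGroup ℋ] [InnerProductSpace ℂ ℋ]

/-- The evolution of a generator on the scale of spaces `ran (S ^ m)`: with `Λ = S⁻¹`, the operator
`W m t` stands for `Λ ^ m U(t, s) S ^ m`. -/
structure IsScaleEvolution (S : ℋ →L[ℂ] ℋ) (h : ℕ → ℝ → (ℋ →L[ℂ] ℋ)) (c : ℕ → ℝ) (s : ℝ)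
    (W : ℕ → ℝ → (ℋ →L[ℂ] ℋ)) : Prop where
  initial : ∀ m, W m s = 1
  intertwine : ∀ m t x, S (W (m + 1) t x) = W m t (S x)
  norm_apply_le : ∀ m t x, ‖W m t x‖ ≤ Real.exp (c m * |t - s|) * ‖x‖
  continuous : ∀ m x, Continuous fun t => W m t x
  hasDerivAt : ∀ m t x,
    HasDerivAt (fun t => W m t (S x)) (-Complex.I • h m t (W (m + 1) t x)) t

variable {S : ℋ →L[ℂ] ℋ} {h : ℕ → ℝ → (ℋ →L[ℂ] ℋ)} {M c : ℕ → ℝ}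

/-- The regularised evolutions converge strongly, locally uniformly in time. On the dense subspace
`ran (S ^ 2)` this follows from the energy estimate for the difference of two of them. -/
theorem IsScaleGenerator.exists_isScaleEvolution [CompleteSpace ℋ] (hS : IsScaleGenerator S h M c)
    (s : ℝ) : ∃ W, IsScaleEvolution S h c s W := by
  set ε : ℕ → ℝ := fun n => 1 / ((n : ℝ) + 1) with hεdef
  have hε : ∀ n, 0 < ε n := fun n => by positivity
  have hεlim : Tendsto ε atTop (𝓝 0) := tendsto_one_div_add_atTop_nhds_zero_nat
  choose G hG using fun n => exists_isShiftedInverse hS.isPositive (hε n)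
  choose W hW using fun n => hS.exists_isRegularisedEvolution (G n) s
  have hD : Dense (Set.range fun x => S (S x)) :=
    hS.denseRange.comp hS.denseRange S.continuous
  have hc := hS.nonneg
  have hball : ∀ {τ t : ℝ}, t ∈ Metric.ball s τ → |t - s| ≤ τ := fun ht => by
    rw [Metric.mem_ball, Real.dist_eq] at ht
    exact ht.le
  have hWn : ∀ (n m : ℕ) (τ : ℝ), ∀ t ∈ Metric.ball s τ, ‖W n m t‖ ≤ Real.exp (c m * τ) := by
    intro n m τ t ht
    refine ContinuousLinearMap.opNorm_le_bound _ (by positivity) fun x => ?_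
    refine ((hW n).norm_apply_le hS (hG n) m t x).trans ?_
    have := hc m
    have := hball ht
    gcongr
  have hUC : ∀ m x τ, UniformCauchySeqOn (fun n t => W n m t x) atTop (Metric.ball s τ) := by
    intro m x τ
    rw [SeminormedAddGroup.uniformCauchySeqOn_iff_tendstoUniformlyOn_zero]
    simp only [neg_add_eq_sub]
    refine tendstoUniformlyOn_zero_of_dense (B := fun p : ℕ × ℕ => fun t => W p.2 m t - W p.1 m t)
      (C := Real.exp (c m * τ) + Real.exp (c m * τ)) (fun p t ht =>
        (_root_.norm_sub_le _ _).trans (add_le_add (hWn _ _ _ t ht) (hWn _ _ _ t ht))) hD ?_ x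
    rintro _ ⟨y, rfl⟩
    have hlim : Tendsto (fun p : ℕ × ℕ => ε p.1 + ε p.2) (atTop ×ˢ atTop) (𝓝 (0 + 0)) :=
      (hεlim.comp tendsto_fst).add (hεlim.comp tendsto_snd)
    have hlim' := hlim.mul_const
      (Real.exp (c m * τ) * ((M (m + 1) + M m) * (Real.exp (c (m + 2) * τ) * ‖y‖) * τ))
    rw [add_zero, zero_mul] at hlim'
    exact tendstoUniformlyOn_zero_of_norm_le hlim' fun p t ht =>
      (norm_sub_rev _ _).trans_le
        ((hW p.1).norm_sub_le hS (hG _) (hε _) (hW p.2) (hG _) (hε _) m (hball ht) y)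
  have hmem : ∀ t, t ∈ Metric.ball s (|t - s| + 1) := fun t => by
    rw [Metric.mem_ball, Real.dist_eq]
    linarith
  have hlim : ∀ m t, ∃ L : ℋ → ℋ, ∀ x, Tendsto (fun n => W n m t x) atTop (𝓝 (L x)) :=
    fun m t => ⟨_, fun x => (cauchySeq_tendsto_of_complete
      ((hUC m x (|t - s| + 1)).cauchy_map (hmem t))).choose_spec⟩
  choose L hL using hlim
  set V : ℕ → ℝ → (ℋ →L[ℂ] ℋ) := fun m t =>
    continuousLinearMapOfTendsto (fun n => W n m t) (tendsto_pi_nhds.2 (hL m t)) with hV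
  have hVlim : ∀ m t x, Tendsto (fun n => W n m t x) atTop (𝓝 (V m t x)) := hL
  have hU : ∀ m x τ, TendstoUniformlyOn (fun n t => W n m t x) (fun t => V m t x) atTop
      (Metric.ball s τ) := fun m x τ =>
    (hUC m x τ).tendstoUniformlyOn_of_tendsto fun t _ => hVlim m t x
  have hVle : ∀ m t x, ‖V m t x‖ ≤ Real.exp (c m * |t - s|) * ‖x‖ := fun m t x =>
    le_of_tendsto (hVlim m t x).norm
      (Eventually.of_forall fun n => (hW n).norm_apply_le hS (hG n) m t x)
  have hVn : ∀ (m : ℕ) (τ : ℝ), ∀ t ∈ Metric.ball s τ, ‖V m t‖ ≤ Real.exp (c m * τ) := by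
    intro m τ t ht
    refine ContinuousLinearMap.opNorm_le_bound _ (by positivity) fun x => (hVle m t x).trans ?_
    have := hc m
    have := hball ht
    gcongr
  have hVS : ∀ m t x, S (V (m + 1) t x) = V m t (S x) := fun m t x =>
    tendsto_nhds_unique ((S.continuous.tendsto _).comp (hVlim (m + 1) t x))
      ((hVlim m t (S x)).congr fun n => ((hW n).intertwine hS (hG n) m t x).symm)
  have hM : ∀ m, 0 ≤ M m := fun m => (norm_nonneg _).trans (hS.norm_le m 0)
  -- Uniform convergence of the derivatives, first on `ran (S ^ 2)`.
  have hder : ∀ m x τ, TendstoUniformlyOn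
      (fun n t => (S * G n * h m t * S * G n * W n (m + 1) t - h m t * V (m + 1) t) x) 0 atTop
      (Metric.ball s τ) := by
    intro m x τ
    refine tendstoUniformlyOn_zero_of_dense
      (B := fun n t => S * G n * h m t * S * G n * W n (m + 1) t - h m t * V (m + 1) t)
      (C := M m * Real.exp (c (m + 1) * τ) + M m * Real.exp (c (m + 1) * τ)) ?_ hD ?_ x
    · intro n t ht
      refine (_root_.norm_sub_le _ _).trans (add_le_add ?_ ?_)
      · refine ContinuousLinearMap.opNorm_le_bound _
          (mul_nonneg (hM m) (Real.exp_pos _).le) fun x => ?_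
        change ‖S (G n (h m t (S (G n (W n (m + 1) t x)))))‖ ≤ _
        refine ((hG n).norm_le _).trans (((h m t).le_opNorm _).trans ?_)
        rw [mul_assoc]
        refine mul_le_mul (hS.norm_le m t) (((hG n).norm_le _).trans ?_) (norm_nonneg _) (hM m)
        exact (ContinuousLinearMap.le_opNorm _ _).trans (by gcongr; exact hWn _ _ _ t ht)
      · refine (norm_mul_le _ _).trans ?_
        exact mul_le_mul (hS.norm_le m t) (hVn _ _ t ht) (norm_nonneg _) (hM m)
    · rintro _ ⟨y, rfl⟩
      have h1 : TendstoUniformlyOn (fun n t => S (G n (h m t (G n (S (S (W n (m + 2) t (S y))))))) -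
          h m t (S (W n (m + 2) t (S y)))) 0 atTop (Metric.ball s τ) := by
        have hl := (hεlim.mul_const (M (m + 1) + M m)).mul_const
          (Real.exp (c (m + 2) * τ) * ‖S y‖)
        rw [zero_mul, zero_mul] at hl
        refine tendstoUniformlyOn_zero_of_norm_le hl fun n t ht => ?_
        refine (hS.norm_regularised_sub_le (hG n) (hε n) m t _).trans ?_
        have := hM m
        have := hM (m + 1)
        have := (hε n).le
        gcongr
        exact (ContinuousLinearMap.le_opNorm _ _).trans (by gcongr; exact hWn _ _ _ t ht)
      have h2 := hU (m + 1) (S (S y)) τ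
      rw [Metric.tendstoUniformlyOn_iff] at h1 h2 ⊢
      intro δ hδ
      have hM1 : 0 < M m + 1 := by linarith [hM m]
      filter_upwards [h1 (δ / 2) (by positivity), h2 (δ / (2 * (M m + 1))) (by positivity)]
        with n hn1 hn2 t ht
      have h3 := hn1 t ht
      have h4 := hn2 t ht
      simp only [Pi.zero_apply, dist_zero_left] at h3 ⊢
      rw [dist_comm, dist_eq_norm] at h4
      have h5 : (S * G n * h m t * S * G n * W n (m + 1) t - h m t * V (m + 1) t) (S (S y)) =
          (S (G n (h m t (G n (S (S (W n (m + 2) t (S y))))))) - h m t (S (W n (m + 2) t (S y)))) +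
          h m t (W n (m + 1) t (S (S y)) - V (m + 1) t (S (S y))) := by
        change S (G n (h m t (S (G n (W n (m + 1) t (S (S y))))))) -
          h m t (V (m + 1) t (S (S y))) = _
        have e : W n (m + 1) t (S (S y)) = S (W n (m + 2) t (S y)) :=
          ((hW n).intertwine hS (hG n) (m + 1) t (S y)).symm
        rw [map_sub, e, (hG n).comm (S _)]
        abel
      rw [h5]
      refine (norm_add_le _ _).trans_lt ?_
      have h6 : ‖h m t (W n (m + 1) t (S (S y)) - V (m + 1) t (S (S y)))‖ ≤ δ / 2 := by
        refine ((h m t).le_opNorm _).trans ?_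
        calc _ ≤ (M m + 1) * (δ / (2 * (M m + 1))) := by
              gcongr
              linarith [hS.norm_le m t]
          _ = δ / 2 := by field_simp
      linarith
  refine ⟨V, fun m => ?_, hVS, hVle, fun m x => ?_, fun m t x => ?_⟩
  · ext x
    refine tendsto_nhds_unique (hVlim m s x) ?_
    simp only [(hW _).initial, one_apply_eq_self]
    exact tendsto_const_nhds
  · rw [continuous_iff_continuousAt]
    intro t
    refine ContinuousOn.continuousAt ?_ (Metric.isOpen_ball.mem_nhds (hmem t))
    refine (hU m x _).continuousOn (Eventually.frequently (Eventually.of_forall fun n r _ => ?_))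
    exact ((hW n).hasDerivAt m r x).continuousAt.continuousWithinAt
  · refine hasDerivAt_of_tendstoUniformlyOn (l := atTop) (s := Metric.ball s (|t - s| + 1))
      (f := fun n t => W n m t (S x))
      (f' := fun n t => -Complex.I • S (G n (h m t (G n (W n m t (S x))))))
      (g' := fun t => -Complex.I • h m t (V (m + 1) t x)) Metric.isOpen_ball
      ?_ (Eventually.of_forall fun n r _ => (hW n).hasDerivAt m r (S x))
      (fun r _ => hVlim m r (S x)) (hmem t)
    have h1 := hder m x (|t - s| + 1)
    rw [Metric.tendstoUniformlyOn_iff] at h1 ⊢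
    intro δ hδ
    filter_upwards [h1 δ hδ] with n hn r hr
    have h2 := hn r hr
    simp only [Pi.zero_apply, dist_zero_left] at h2
    rw [dist_comm, dist_eq_norm, ← smul_sub, norm_smul, norm_neg, Complex.norm_I, one_mul,
      ← (hW n).intertwine hS (hG n), ← (hG n).comm]
    exact h2

end Scale

end ConstDom

namespace ConstDom

section Operators
variable {ℋ : Type*} [NormedAddCommGroup ℋ] [InnerProductSpace ℂ ℋ]

/-! ### Unbounded operators: values and domains of products -/

theorem mem_pcomp_iff (A B : ℋ →ₗ.[ℂ] ℋ) (ψ : ℋ) :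
    ψ ∈ (pcomp A B).domain ↔ ψ ∈ B.domain ∧ ap B ψ ∈ A.domain := by
  rw [mem_pcomp_domain]
  constructor
  · rintro ⟨h, h'⟩
    exact ⟨h, by rwa [ap_of_mem B h]⟩
  · rintro ⟨h, h'⟩
    exact ⟨h, by rwa [ap_of_mem B h] at h'⟩

theorem ap_pcomp {A B : ℋ →ₗ.[ℂ] ℋ} {ψ : ℋ} (h : ψ ∈ (pcomp A B).domain) :
    ap (pcomp A B) ψ = ap A (ap B ψ) := by
  obtain ⟨h1, h2⟩ := (mem_pcomp_domain A B ψ).1 h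
  rw [ap_of_mem _ h, pcomp_apply A B h1 h2, ap_of_mem B h1, ap_of_mem A h2]

theorem ap_pcomm {A B : ℋ →ₗ.[ℂ] ℋ} {ψ : ℋ} (h : ψ ∈ (pcomp A B).domain)
    (h' : ψ ∈ (pcomp B A).domain) : ψ ∈ (pcomm A B).domain ∧
      ap (pcomm A B) ψ = ap A (ap B ψ) - ap B (ap A ψ) := by
  have h1 : ψ ∈ (pcomm A B).domain := ⟨h, h'⟩
  refine ⟨h1, ?_⟩
  rw [← ap_pcomp h, ← ap_pcomp h', ap_of_mem _ h1, ap_of_mem _ h, ap_of_mem _ h']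
  rfl

theorem ap_sub (A : ℋ →ₗ.[ℂ] ℋ) {φ ψ : ℋ} (hφ : φ ∈ A.domain) (hψ : ψ ∈ A.domain) :
    ap A (φ - ψ) = ap A φ - ap A ψ := by
  rw [ap_of_mem _ hφ, ap_of_mem _ hψ, ap_of_mem _ (A.domain.sub_mem hφ hψ), ← LinearPMap.map_sub]
  rfl

theorem inner_ap_symm [CompleteSpace ℋ] {A : ℋ →ₗ.[ℂ] ℋ} (hA : IsSelfAdjoint A) {φ ψ : ℋ}
    (hφ : φ ∈ A.domain) (hψ : ψ ∈ A.domain) : inner ℂ (ap A φ) ψ = inner ℂ φ (ap A ψ) := by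
  have h := A.adjoint_isFormalAdjoint hA.dense_domain
  rw [LinearPMap.isSelfAdjoint_def.1 hA] at h
  rw [ap_of_mem _ hφ, ap_of_mem _ hψ]
  exact h.symm ⟨φ, hφ⟩ ⟨ψ, hψ⟩

theorem re_inner_I_smul_ap [CompleteSpace ℋ] {A : ℋ →ₗ.[ℂ] ℋ} (hA : IsSelfAdjoint A) {ψ : ℋ}
    (hψ : ψ ∈ A.domain) : (inner ℂ ψ (-Complex.I • ap A ψ)).re = 0 := by
  have h : (inner ℂ ψ (ap A ψ)).im = 0 := by
    rw [← Complex.conj_eq_iff_im, inner_conj_symm, inner_ap_symm hA hψ hψ]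
  rw [inner_smul_right]
  simp [h]

/-! ### The resolvent at `-1` and the domains of the powers -/

/-- `S = (A + 1)⁻¹`, for a positive operator `A`. -/
structure IsResolvent (A : ℋ →ₗ.[ℂ] ℋ) (S : ℋ →L[ℂ] ℋ) : Prop where
  isPositive : S.IsPositive
  mem : ∀ x, S x ∈ A.domain
  ap_apply : ∀ x, ap A (S x) = x - S x
  apply_ap : ∀ ψ ∈ A.domain, S (ap A ψ + ψ) = ψ

theorem exists_isResolvent [CompleteSpace ℋ] {A : ℋ →ₗ.[ℂ] ℋ} (hA : IsSelfAdjoint A)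
    (hpos : ∀ ψ : A.domain, 0 ≤ (inner ℂ (ψ : ℋ) (A ψ)).re) : ∃ S, IsResolvent A S := by
  have hpos' : ∀ ψ ∈ A.domain, 0 ≤ (inner ℂ ψ (ap A ψ)).re := fun ψ hψ => by
    rw [ap_of_mem _ hψ]
    exact hpos ⟨ψ, hψ⟩
  have hlow : ∀ ψ ∈ A.domain, ‖ψ‖ ≤ ‖ψ + ap A ψ‖ := fun ψ hψ => by
    have h1 : ‖ψ + ap A ψ‖ ^ 2 = ‖ψ‖ ^ 2 + 2 * (inner ℂ ψ (ap A ψ)).re + ‖ap A ψ‖ ^ 2 :=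
      @norm_add_sq ℂ _ _ _ _ ψ (ap A ψ)
    refine le_of_sq_le_sq ?_ (norm_nonneg _)
    have := hpos' ψ hψ
    nlinarith [sq_nonneg ‖ap A ψ‖]
  have hgraph : ∀ p : A.graph, p.1.1 ∈ A.domain ∧ ap A p.1.1 = p.1.2 := fun p => by
    obtain ⟨y, hy1, hy2⟩ := LinearPMap.mem_graph_iff A |>.1 p.2
    rw [← hy1, ap_of_mem _ y.2]
    exact ⟨y.2, hy2⟩
  have hclosed : IsClosed (A.graph : Set (ℋ × ℋ)) := hA.isClosed
  have : CompleteSpace A.graph := hclosed.completeSpace_coe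
  -- `A + 1` is studied as a bounded operator on the graph of `A`.
  let f : A.graph →L[ℂ] ℋ :=
    (ContinuousLinearMap.fst ℂ ℋ ℋ + ContinuousLinearMap.snd ℂ ℋ ℋ).comp A.graph.subtypeL
  have hf : ∀ p, f p = p.1.1 + p.1.2 := fun _ => rfl
  have hanti : AntilipschitzWith 2 f := by
    refine ContinuousLinearMap.antilipschitz_of_bound f fun p => ?_
    obtain ⟨h1, h2⟩ := hgraph p
    have h3 := hlow _ h1
    rw [h2] at h3
    have h4 : ‖p.1.2‖ ≤ ‖p.1.1 + p.1.2‖ + ‖p.1.1‖ := by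
      conv_lhs => rw [← add_sub_cancel_left p.1.1 p.1.2]
      exact norm_sub_le _ _
    have h5 : ‖p.1.1‖ ≤ 2 * ‖p.1.1 + p.1.2‖ := by linarith [norm_nonneg (p.1.1 + p.1.2)]
    have h6 : ‖p.1.2‖ ≤ 2 * ‖p.1.1 + p.1.2‖ := by linarith
    exact max_le h5 h6
  have hran : f.range = ⊤ := by
    have hc : IsClosed (f.range : Set ℋ) := by
      have := hanti.isClosed_range f.uniformContinuous
      exact this
    have : CompleteSpace f.range := hc.completeSpace_coe
    rw [← Submodule.orthogonal_eq_bot_iff, Submodule.eq_bot_iff]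
    intro χ hχ
    have h1 : ∀ ψ : A.domain, inner ℂ (-χ) (ψ : ℋ) = inner ℂ χ (A ψ) := fun ψ => by
      have h2 := Submodule.inner_left_of_mem_orthogonal (K := f.range) (v := χ)
        ⟨⟨((ψ : ℋ), A ψ), A.mem_graph ψ⟩, rfl⟩ hχ
      have h3 : inner ℂ χ ((ψ : ℋ) + A ψ) = 0 := h2
      rw [inner_add_right] at h3
      rw [inner_neg_left]
      linear_combination -h3
    have h2 : χ ∈ A.domain := by
      have := LinearPMap.mem_adjoint_domain_of_exists (T := A) χ ⟨-χ, h1⟩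
      rwa [LinearPMap.isSelfAdjoint_def.1 hA] at this
    have h3 : χ + ap A χ = 0 := by
      refine hA.dense_domain.eq_zero_of_inner_left ℂ fun ψ hψ => ?_
      have := h1 ⟨ψ, hψ⟩
      rw [inner_neg_left, ← ap_of_mem A hψ, ← inner_ap_symm hA h2 hψ] at this
      rw [inner_add_left, ← this]
      ring
    have h4 := hlow χ h2
    rw [h3, norm_zero] at h4
    exact norm_le_zero_iff.1 h4
  have hker : f.ker = ⊥ := LinearMap.ker_eq_bot.2 hanti.injective
  let e := ContinuousLinearEquiv.ofBijective f hker hran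
  let S : ℋ →L[ℂ] ℋ := ((ContinuousLinearMap.fst ℂ ℋ ℋ).comp A.graph.subtypeL).comp
    (e.symm : ℋ →L[ℂ] A.graph)
  have hmem : ∀ x, S x ∈ A.domain := fun x => (hgraph (e.symm x)).1
  have hadd : ∀ x, S x + ap A (S x) = x := fun x => by
    have h1 : f (e.symm x) = x := e.apply_symm_apply x
    rw [hf, ← (hgraph (e.symm x)).2] at h1
    exact h1
  refine ⟨S, ?_, hmem, fun x => eq_sub_of_add_eq' (hadd x), fun ψ hψ => ?_⟩
  · refine ⟨fun x y => ?_, fun x => ?_⟩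
    · change inner ℂ (S x) y = inner ℂ x (S y)
      conv_lhs => rw [← hadd y]
      conv_rhs => rw [← hadd x]
      rw [inner_add_left, inner_add_right, inner_ap_symm hA (hmem x) (hmem y)]
    · change 0 ≤ (inner ℂ (S x) x).re
      have h0 : inner ℂ (S x) x = inner ℂ (S x) (S x + ap A (S x)) := by rw [hadd]
      rw [h0, inner_add_right, Complex.add_re]
      have h1 : 0 ≤ (inner ℂ (S x) (S x)).re := inner_self_nonneg (𝕜 := ℂ)
      exact add_nonneg h1 (hpos' _ (hmem x))
  · have h1 := hlow _ (A.domain.sub_mem (hmem (ap A ψ + ψ)) hψ)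
    rw [ap_sub A (hmem _) hψ, sub_add_sub_comm, hadd, add_comm ψ, sub_self, norm_zero] at h1
    exact sub_eq_zero.1 (norm_le_zero_iff.1 h1)

namespace IsResolvent

variable {A : ℋ →ₗ.[ℂ] ℋ} {S : ℋ →L[ℂ] ℋ}

theorem injective (hS : IsResolvent A S) : Function.Injective S := by
  refine (injective_iff_map_eq_zero S).2 fun x hx => ?_
  have h1 := hS.ap_apply x
  have h2 : ap A 0 = 0 := by rw [ap_of_mem _ A.domain.zero_mem]; exact A.map_zero
  rw [hx, h2, sub_zero] at h1
  exact h1.symm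

theorem pow_injective (hS : IsResolvent A S) (m : ℕ) : Function.Injective ⇑(S ^ m) := by
  rw [FunLike.coe_pow_eq_iterate]
  exact hS.injective.iterate m

theorem commute_one_sub (S : ℋ →L[ℂ] ℋ) : Commute (1 - S) S :=
  (Commute.one_left S).sub_left (Commute.refl S)

/-- The value of `A ^ m` on the range of `S ^ m`. -/
theorem ppow_pow (hS : IsResolvent A S) (m : ℕ) (x : ℋ) :
    (S ^ m) x ∈ (ppow A m).domain ∧ ap (ppow A m) ((S ^ m) x) = ((1 - S) ^ m) x := by
  induction m generalizing x with
  | zero =>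
    have h : x ∈ (ppow A 0).domain := trivial
    simp only [pow_zero, one_apply_eq_self]
    exact ⟨h, ap_of_mem _ h⟩
  | succ m ih =>
    obtain ⟨h1, h2⟩ := ih (S x)
    have h3 : (S ^ (m + 1)) x = (S ^ m) (S x) := by rw [pow_succ]; rfl
    have h4 : ((1 - S) ^ m) (S x) = S (((1 - S) ^ m) x) :=
      DFunLike.congr_fun ((commute_one_sub S).pow_left m).eq x
    have h5 : (S ^ (m + 1)) x ∈ (pcomp A (ppow A m)).domain := by
      rw [mem_pcomp_iff, h3, h2, h4]
      exact ⟨h1, hS.mem _⟩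
    refine ⟨h5, ?_⟩
    change ap (pcomp A (ppow A m)) _ = _
    rw [ap_pcomp h5, h3, h2, h4, hS.ap_apply, pow_succ']
    rfl

theorem ppow_pow_of_le (hS : IsResolvent A S) {k m : ℕ} (hk : k ≤ m) (x : ℋ) :
    (S ^ m) x ∈ (ppow A k).domain ∧
      ap (ppow A k) ((S ^ m) x) = ((1 - S) ^ k * S ^ (m - k)) x := by
  have h : (S ^ m) x = (S ^ k) ((S ^ (m - k)) x) := by
    rw [← mul_apply_eq_comp, ← pow_add, Nat.add_sub_cancel' hk]
  rw [h]
  exact hS.ppow_pow k _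

theorem mem_ppow_domain_iff (hS : IsResolvent A S) (m : ℕ) (ψ : ℋ) :
    ψ ∈ (ppow A m).domain ↔ ∃ x, (S ^ m) x = ψ := by
  constructor
  · induction m generalizing ψ with
    | zero => exact fun _ => ⟨ψ, by simp⟩
    | succ m ih =>
      intro h
      obtain ⟨h1, h2⟩ := (mem_pcomp_iff A (ppow A m) ψ).1 h
      obtain ⟨y, rfl⟩ := ih ψ h1
      rw [(hS.ppow_pow m y).2] at h2
      -- Modulo `ran S`, the operator `1 - S` is the identity.
      have h3 : ∀ (k : ℕ) (z : ℋ), ((1 - S) ^ k) z ∈ A.domain → z ∈ A.domain := by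
        intro k
        induction k with
        | zero => exact fun z hz => by simpa using hz
        | succ k ihk =>
          intro z hz
          have h4 : z - S z ∈ A.domain := ihk _ (by rw [pow_succ] at hz; exact hz)
          simpa using A.domain.add_mem h4 (hS.mem z)
      refine ⟨ap A y + y, ?_⟩
      rw [pow_succ, mul_apply_eq_comp, hS.apply_ap y (h3 m y h2)]
  · rintro ⟨x, rfl⟩
    exact (hS.ppow_pow m x).1

theorem mem_domain_iff (hS : IsResolvent A S) (ψ : ℋ) : ψ ∈ A.domain ↔ ∃ x, S x = ψ :=
  ⟨fun h => ⟨_, hS.apply_ap ψ h⟩, fun ⟨x, hx⟩ => hx ▸ hS.mem x⟩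

theorem mem_cinfty_iff (hS : IsResolvent A S) (ψ : ℋ) :
    ψ ∈ cinfty A ↔ ∀ m : ℕ, ∃ x, (S ^ m) x = ψ := by
  simp only [cinfty, Submodule.mem_iInf, hS.mem_ppow_domain_iff]

/-- The binomial expansion of `1 = ((1 - S) + S) ^ m`. -/
theorem sum_choose_eq_one (S : ℋ →L[ℂ] ℋ) (m : ℕ) :
    ∑ k ∈ Finset.range (m + 1), (m.choose k : ℂ) • ((1 - S) ^ k * S ^ (m - k)) = 1 := by
  have h := (commute_one_sub S).add_pow m
  rw [sub_add_cancel, one_pow] at h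
  refine Eq.trans (Finset.sum_congr rfl fun k _ => ?_) h.symm
  rw [Nat.cast_smul_eq_nsmul, nsmul_eq_mul, (Nat.cast_commute _ _).eq]

/-- `S ^ (-m)` is bounded relative to `A ^ m`: the polynomials `(1 - X) ^ m` and `X ^ m` are
coprime. -/
theorem exists_norm_le (hS : IsResolvent A S) (m : ℕ) : ∃ C : ℝ, 0 ≤ C ∧
    ∀ x, ‖x‖ ≤ C * (‖ap (ppow A m) ((S ^ m) x)‖ + ‖(S ^ m) x‖) := by
  have hcop : IsCoprime ((1 - Polynomial.X : Polynomial ℂ) ^ m) (Polynomial.X ^ m) :=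
    IsCoprime.pow ⟨1, 1, by ring⟩
  obtain ⟨p, q, hpq⟩ := hcop
  have h1 := congrArg (Polynomial.aeval S) hpq
  simp only [map_add, map_mul, map_pow, map_sub, map_one, Polynomial.aeval_X] at h1
  set P := Polynomial.aeval S p
  set Q := Polynomial.aeval S q
  refine ⟨‖P‖ + ‖Q‖, by positivity, fun x => ?_⟩
  rw [(hS.ppow_pow m x).2]
  have h2 : x = P (((1 - S) ^ m) x) + Q ((S ^ m) x) := (DFunLike.congr_fun h1 x).symm
  calc ‖x‖ = ‖P (((1 - S) ^ m) x) + Q ((S ^ m) x)‖ := by rw [← h2]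
    _ ≤ ‖P‖ * ‖((1 - S) ^ m) x‖ + ‖Q‖ * ‖(S ^ m) x‖ :=
        (norm_add_le _ _).trans (add_le_add (P.le_opNorm _) (Q.le_opNorm _))
    _ ≤ _ := by
        have := mul_nonneg (norm_nonneg P) (norm_nonneg ((S ^ m) x))
        have := mul_nonneg (norm_nonneg Q) (norm_nonneg (((1 - S) ^ m) x))
        linarith

end IsResolvent

end Operators

end ConstDom

namespace ConstDom

section Operators
variable {ℋ : Type*} [NormedAddCommGroup ℋ] [InnerProductSpace ℂ ℋ]

/-! ### The Hamiltonian as a generator on the scale -/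

theorem RelBounds.exists_bounded {A : ℋ →ₗ.[ℂ] ℋ} {B : ℝ → (ℋ →ₗ.[ℂ] ℋ)} (hB : RelBounds A B)
    {S : ℋ →L[ℂ] ℋ} (hS : IsResolvent A S) (k : ℕ) : ∃ g : ℝ → (ℋ →L[ℂ] ℋ),
      (∀ t x, g t x = ap (pcomp (ppow A k) (B t)) ((S ^ (k + 1)) x)) ∧
      ∀ c d : ℝ, ∃ C, ∀ t ∈ Set.Icc c d, ‖g t‖ ≤ C := by
  obtain ⟨hdom, hbd⟩ := hB k
  have hmem : ∀ t x, (S ^ (k + 1)) x ∈ (pcomp (ppow A k) (B t)).domain := fun t x =>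
    hdom t (hS.ppow_pow (k + 1) x).1
  have key : ∀ (a b : ℝ) (t : ℝ), 0 ≤ a → 0 ≤ b → (∀ ψ ∈ (ppow A (k + 1)).domain,
      ‖ap (pcomp (ppow A k) (B t)) ψ‖ ≤ a * ‖ap (ppow A (k + 1)) ψ‖ + b * ‖ψ‖) →
      ∀ x, ‖ap (pcomp (ppow A k) (B t)) ((S ^ (k + 1)) x)‖ ≤
        (a * ‖(1 - S) ^ (k + 1)‖ + b * ‖S ^ (k + 1)‖) * ‖x‖ := by
    intro a b t ha hb h x
    obtain ⟨h1, h2⟩ := hS.ppow_pow (k + 1) x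
    have h3 := h _ h1
    rw [h2] at h3
    refine h3.trans ?_
    rw [add_mul, mul_assoc, mul_assoc]
    gcongr
    exacts [ContinuousLinearMap.le_opNorm _ _, ContinuousLinearMap.le_opNorm _ _]
  let L : ℝ → (ℋ →ₗ[ℂ] ℋ) := fun t => (pcomp (ppow A k) (B t)).toFun.comp
    ((S ^ (k + 1)).toLinearMap.codRestrict _ (hmem t))
  have hL : ∀ t x, L t x = ap (pcomp (ppow A k) (B t)) ((S ^ (k + 1)) x) := fun t x =>
    (ap_of_mem _ (hmem t x)).symm
  have hbdt : ∀ t, ∃ C, ∀ x, ‖L t x‖ ≤ C * ‖x‖ := fun t => by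
    obtain ⟨a, b, ha, hb, h⟩ := hbd t t
    exact ⟨_, fun x => (hL t x).symm ▸ key a b t ha hb (h t ⟨le_rfl, le_rfl⟩) x⟩
  refine ⟨fun t => (L t).mkContinuousOfExistsBound (hbdt t), hL, fun c d => ?_⟩
  obtain ⟨a, b, ha, hb, h⟩ := hbd c d
  refine ⟨a * ‖(1 - S) ^ (k + 1)‖ + b * ‖S ^ (k + 1)‖, fun t ht => ?_⟩
  refine ContinuousLinearMap.opNorm_le_bound _ (by positivity) fun x => ?_
  exact (hL t x).symm ▸ key a b t ha hb (h t ht) x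

/-- A strongly differentiable operator family with locally bounded derivative is norm continuous. -/
theorem continuous_of_hasDerivAt_apply {g v : ℝ → (ℋ →L[ℂ] ℋ)}
    (hg : ∀ x t, HasDerivAt (fun t => g t x) (v t x) t)
    (hv : ∀ c d : ℝ, ∃ C, ∀ t ∈ Set.Icc c d, ‖v t‖ ≤ C) : Continuous g := by
  rw [continuous_iff_continuousAt]
  intro t
  obtain ⟨C, hC⟩ := hv (t - 1) (t + 1)
  have hmem : t ∈ Set.Icc (t - 1) (t + 1) := ⟨by linarith, by linarith⟩
  have hC0 : 0 ≤ C := (norm_nonneg _).trans (hC t hmem)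
  refine continuousAt_of_locally_lipschitz (r := 1) one_pos C fun r hr => ?_
  rw [Real.dist_eq, abs_lt] at hr
  rw [dist_eq_norm, dist_eq_norm]
  refine ContinuousLinearMap.opNorm_le_bound _ (by positivity) fun x => ?_
  have := (convex_Icc (t - 1) (t + 1)).norm_image_sub_le_of_norm_hasDerivWithin_le
    (f := fun t => g t x) (C := C * ‖x‖) (fun r _ => (hg x r).hasDerivWithinAt)
    (fun r hr => (ContinuousLinearMap.le_opNorm _ _).trans (by gcongr; exact hC r hr))
    hmem (⟨by linarith [hr.1], by linarith [hr.2]⟩ : r ∈ Set.Icc (t - 1) (t + 1))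
  calc _ ≤ _ := this
    _ = _ := by ring

variable [CompleteSpace ℋ] {H₀ : ℋ →ₗ.[ℂ] ℋ} {H : ℝ → (ℋ →ₗ.[ℂ] ℋ)}

theorem HamiltonianAssumptions.exists_eq_mem_Icc (hH : HamiltonianAssumptions H₀ H) (t : ℝ) :
    ∃ r ∈ Set.Icc (0 : ℝ) 1, H t = H r := by
  have hp : Function.Periodic H 1 := hH.periodic
  obtain ⟨r, hr, h⟩ := hp.exists_mem_Ico₀ one_pos t
  exact ⟨r, ⟨hr.1, hr.2.le⟩, h⟩

/-- The operators `H₀ ^ k H(t) S ^ (k + 1)` are bounded uniformly in time, because of periodicity,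
and norm continuous in time. -/
theorem HamiltonianAssumptions.exists_continuous_bounded (hH : HamiltonianAssumptions H₀ H)
    {S : ℋ →L[ℂ] ℋ} (hS : IsResolvent H₀ S) (k : ℕ) :
    ∃ g : ℝ → (ℋ →L[ℂ] ℋ), Continuous g ∧ (∃ C, ∀ t, ‖g t‖ ≤ C) ∧
      ∀ t x, g t x = ap (pcomp (ppow H₀ k) (H t)) ((S ^ (k + 1)) x) := by
  obtain ⟨H', hH', hd⟩ := hH.diff
  obtain ⟨g, hg, hgb⟩ := hH.bound.exists_bounded hS k
  obtain ⟨v, hv, hvb⟩ := hH'.exists_bounded hS k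
  refine ⟨g, continuous_of_hasDerivAt_apply (fun x t => ?_) hvb, ?_, hg⟩
  · simp only [hg, hv]
    exact (hd k _ (hS.ppow_pow (k + 1) x).1).1 t
  · obtain ⟨C, hC⟩ := hgb 0 1
    refine ⟨C, fun t => ?_⟩
    obtain ⟨r, hr, h⟩ := hH.exists_eq_mem_Icc t
    have : g t = g r := by ext x; rw [hg, hg, h]
    rw [this]
    exact hC r hr

/-- The Hamiltonian on the scale of the domains `D(H₀ ^ m) = ran (S ^ m)`. The operator
`h m t = S ^ (-m) H(t) S ^ (m + 1)` is expressed through `H₀ ^ k H(t) S ^ (k + 1)`, `k ≤ m`, by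
expanding `S ^ (-m) = (1 + H₀) ^ m`. -/
theorem HamiltonianAssumptions.exists_isScaleGenerator (hH : HamiltonianAssumptions H₀ H)
    {S : ℋ →L[ℂ] ℋ} (hS : IsResolvent H₀ S) :
    ∃ h M c, IsScaleGenerator S h M c ∧
      ∀ m t x, ap (H t) ((S ^ (m + 1)) x) = (S ^ m) (h m t x) := by
  choose g hgc hgb hg using hH.exists_continuous_bounded hS
  choose C hC using hgb
  set h : ℕ → ℝ → (ℋ →L[ℂ] ℋ) := fun m t =>
    ∑ k ∈ Finset.range (m + 1), (m.choose k : ℂ) • (g k t * S ^ (m - k)) with hh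
  have hsum : ∀ m t x, h m t x =
      ∑ k ∈ Finset.range (m + 1), (m.choose k : ℂ) • g k t ((S ^ (m - k)) x) := by
    intro m t x
    simp [hh]
  have hdom : ∀ m t x, (S ^ (m + 1)) x ∈ (pcomp (ppow H₀ m) (H t)).domain := fun m t x =>
    (hH.bound m).1 t (hS.ppow_pow (m + 1) x).1
  have hpow : ∀ {k m : ℕ} (x : ℋ), k ≤ m →
      (S ^ (k + 1)) ((S ^ (m - k)) x) = (S ^ (m + 1)) x := fun {k m} x hk => by
    rw [← mul_apply_eq_comp, ← pow_add]
    congr 2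
    omega
  have hpow1 : ∀ (m : ℕ) (x : ℋ), (S ^ (m + 1)) x = (S ^ m) (S x) := fun m x => by
    rw [pow_succ, mul_apply_eq_comp]
  have hone : ∀ (m : ℕ) (z : ℋ),
      ∑ k ∈ Finset.range (m + 1), (m.choose k : ℂ) • ((1 - S) ^ k * S ^ (m - k)) z = z := by
    intro m z
    have := DFunLike.congr_fun (IsResolvent.sum_choose_eq_one S m) z
    simpa [sum_apply] using this
  have happ : ∀ m t x, ap (H t) ((S ^ (m + 1)) x) = (S ^ m) (h m t x) := by
    intro m t x
    obtain ⟨-, h1⟩ := (mem_pcomp_iff _ _ _).1 (hdom m t x)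
    obtain ⟨z, hz⟩ := (hS.mem_ppow_domain_iff m _).1 h1
    have h2 : h m t x = z := by
      rw [hsum, ← hone m z]
      refine Finset.sum_congr rfl fun k hk => ?_
      have hk' : k ≤ m := Nat.lt_succ_iff.1 (Finset.mem_range.1 hk)
      rw [hg, ap_pcomp (hdom k t _), hpow x hk', ← hz, (hS.ppow_pow_of_le hk' z).2]
    rw [h2, hz]
  have happ0 : ∀ t x, ap (H t) (S x) = h 0 t x := fun t x => by
    have := happ 0 t x
    simpa using this
  choose a b ha hb hab using fun k => hH.commutator k 0 1
  refine ⟨h, fun m => ∑ k ∈ Finset.range (m + 1), (m.choose k : ℝ) * (C k * ‖S ^ (m - k)‖),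
    fun m => ∑ k ∈ Finset.range (m + 1), (m.choose k : ℝ) *
      (a k * ‖(1 - S) ^ k * S ^ (m - k)‖ + b k * ‖S ^ m‖), ⟨hS.isPositive, hS.injective,
    fun m t x => ?_, fun t x y => ?_, fun m => ?_, fun m t => ?_, fun m => ?_, fun m t x => ?_⟩,
    happ⟩
  · refine hS.pow_injective m ?_
    rw [← hpow1, ← happ, ← happ, ← hpow1]
  · have hmem : ∀ x, S x ∈ (H t).domain := fun x => hH.domain_eq t ▸ hS.mem x
    rw [← happ0, ← happ0, inner_ap_symm (hH.selfAdjoint t) (hmem x) (hmem y)]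
  · exact continuous_finsetSum _ fun k _ =>
      ((hgc k).mul continuous_const).const_smul (m.choose k : ℂ)
  · refine (norm_sum_le _ _).trans (Finset.sum_le_sum fun k _ => ?_)
    rw [norm_smul, Complex.norm_natCast]
    gcongr
    refine (norm_mul_le _ _).trans ?_
    gcongr
    exact hC k t
  · exact Finset.sum_nonneg fun k _ => by have := ha k; have := hb k; positivity
  · obtain ⟨r, hr, hHr⟩ := hH.exists_eq_mem_Icc t
    have h0 : h 0 t x = ∑ k ∈ Finset.range (m + 1),
        (m.choose k : ℂ) • h 0 t (((1 - S) ^ k * S ^ (m - k)) x) := by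
      conv_lhs => rw [← hone m x]
      simp only [map_sum, map_smul]
    rw [hsum m, h0, ← Finset.sum_sub_distrib, Finset.sum_mul]
    refine (norm_sum_le _ _).trans (Finset.sum_le_sum fun k hk => ?_)
    have hk' : k ≤ m := Nat.lt_succ_iff.1 (Finset.mem_range.1 hk)
    rw [← smul_sub, norm_smul, Complex.norm_natCast, mul_assoc]
    gcongr
    -- Each term is a commutator `[H₀ ^ k, H(t)]`, applied to `S ^ (m + 1) x`.
    obtain ⟨hp1, hp2⟩ := hS.ppow_pow_of_le hk' (S x)
    rw [← hpow1] at hp1 hp2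
    have hcomm : ((1 - S) ^ k * S ^ (m - k)) (S x) = S (((1 - S) ^ k * S ^ (m - k)) x) :=
      DFunLike.congr_fun ((((IsResolvent.commute_one_sub S).pow_left k).mul_left
        ((Commute.refl S).pow_left (m - k))).eq) x
    have hmem1 : (S ^ (m + 1)) x ∈ (pcomp (ppow H₀ k) (H t)).domain := by
      rw [← hpow x hk']
      exact hdom k t _
    have hmem2 : (S ^ (m + 1)) x ∈ (pcomp (H t) (ppow H₀ k)).domain := by
      rw [mem_pcomp_iff, hp2, hcomm, hH.domain_eq]
      exact ⟨hp1, hS.mem _⟩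
    obtain ⟨hc1, hc2⟩ := ap_pcomm hmem1 hmem2
    have h1 : g k t ((S ^ (m - k)) x) - h 0 t (((1 - S) ^ k * S ^ (m - k)) x) =
        ap (pcomm (ppow H₀ k) (H t)) ((S ^ (m + 1)) x) := by
      rw [hc2, hg, hpow x hk', ap_pcomp hmem1, hp2, hcomm, happ0]
    rw [h1]
    rw [hHr] at hc1 ⊢
    refine (hab k r hr _ hc1).trans ?_
    rw [hp2, hpow1, add_mul, mul_assoc, mul_assoc]
    have := ha k
    have := hb k
    gcongr
    exacts [ContinuousLinearMap.le_opNorm _ _, ContinuousLinearMap.le_opNorm _ _]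

end Operators

end ConstDom

namespace ConstDom

section Propagator
variable {ℋ : Type*} [NormedAddCommGroup ℋ] [InnerProductSpace ℂ ℋ]

/-! ### Solutions of the Schrödinger equation -/

variable {H₀ : ℋ →ₗ.[ℂ] ℋ} {B : ℝ → (ℋ →ₗ.[ℂ] ℋ)}

namespace IsSolution

variable {s : ℝ} {ψ₀ : ℋ} {φ : ℝ → ℋ}

theorem restart (hφ : IsSolution H₀ B s ψ₀ φ) (r : ℝ) : IsSolution H₀ B r (φ r) φ :=
  { hφ with initial := rfl }

theorem norm_le [CompleteSpace ℋ] (hφ : IsSolution H₀ B s ψ₀ φ) (hB : ∀ t, IsSelfAdjoint (B t))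
    (t : ℝ) : ‖φ t‖ ≤ ‖ψ₀‖ := by
  have := norm_le_exp_of_abs_re_inner_deriv_le (c := 0) (F := 0) (s := s) (τ := |t - s|) le_rfl
    le_rfl hφ.hasDerivAt
    (fun r _ => by simp only [re_inner_I_smul_ap (hB r) (hφ.mem_domain r)]; simp) (t := t) le_rfl
  simpa [hφ.initial] using this

theorem sub (hφ : IsSolution H₀ B s ψ₀ φ) {ψ₁ : ℋ} {χ : ℝ → ℋ} (hχ : IsSolution H₀ B s ψ₁ χ) :
    IsSolution H₀ B s (ψ₀ - ψ₁) (fun t => φ t - χ t) where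
  initial := by rw [hφ.initial, hχ.initial]
  mem_domain₀ t := H₀.domain.sub_mem (hφ.mem_domain₀ t) (hχ.mem_domain₀ t)
  mem_domain t := (B t).domain.sub_mem (hφ.mem_domain t) (hχ.mem_domain t)
  continuous_graph := (hφ.continuous_graph.sub hχ.continuous_graph).congr fun t => by
    rw [ap_sub _ (hφ.mem_domain₀ t) (hχ.mem_domain₀ t)]
    rfl
  contDiff := hφ.contDiff.sub hχ.contDiff
  hasDerivAt t := ((hφ.hasDerivAt t).sub (hχ.hasDerivAt t)).congr_deriv <| by
    rw [ap_sub _ (hφ.mem_domain t) (hχ.mem_domain t), smul_sub]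

theorem eq [CompleteSpace ℋ] (hφ : IsSolution H₀ B s ψ₀ φ) {χ : ℝ → ℋ}
    (hχ : IsSolution H₀ B s ψ₀ χ) (hB : ∀ t, IsSelfAdjoint (B t)) : φ = χ := by
  funext t
  have := (hφ.sub hχ).norm_le hB t
  rw [sub_self, norm_zero, norm_le_zero_iff] at this
  exact sub_eq_zero.1 this

end IsSolution

variable {S : ℋ →L[ℂ] ℋ} {h : ℕ → ℝ → (ℋ →L[ℂ] ℋ)} {M c : ℕ → ℝ} {s : ℝ}
  {W : ℕ → ℝ → (ℋ →L[ℂ] ℋ)}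

theorem IsScaleEvolution.intertwine_pow (hW : IsScaleEvolution S h c s W) (m : ℕ) (t : ℝ) (x : ℋ) :
    W 0 t ((S ^ m) x) = (S ^ m) (W m t x) := by
  induction m generalizing x with
  | zero => simp
  | succ m ih =>
    rw [pow_succ, mul_apply_eq_comp, ih, ← hW.intertwine, mul_apply_eq_comp]

/-- The scale evolution solves the Schrödinger equation. -/
theorem IsScaleEvolution.isSolution (hW : IsScaleEvolution S h c s W)
    (hh : IsScaleGenerator S h M c) (hS : IsResolvent H₀ S)
    (hdom : ∀ t, (B t).domain = H₀.domain) (hap : ∀ t x, ap (B t) (S x) = h 0 t x) (x : ℋ) :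
    IsSolution H₀ B s (S x) (fun t => W 0 t (S x)) := by
  have hd : ∀ t, HasDerivAt (fun t => W 0 t (S x)) (-Complex.I • h 0 t (W 1 t x)) t :=
    fun t => hW.hasDerivAt 0 t x
  have hSW : ∀ t, W 0 t (S x) = S (W 1 t x) := fun t => (hW.intertwine 0 t x).symm
  have hc1 : Continuous fun t => W 1 t x := hW.continuous 1 x
  refine ⟨by simp [hW.initial], fun t => ?_, fun t => ?_, ?_, ?_, fun t => ?_⟩
  · rw [hSW]
    exact hS.mem _
  · rw [hSW, hdom]
    exact hS.mem _
  · simp only [hSW, hS.ap_apply]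
    exact (S.continuous.comp hc1).prodMk (hc1.sub (S.continuous.comp hc1))
  · rw [contDiff_one_iff_deriv]
    refine ⟨fun t => (hd t).differentiableAt, ?_⟩
    rw [show deriv (fun t => W 0 t (S x)) = fun t => -Complex.I • h 0 t (W 1 t x) from
      funext fun t => (hd t).deriv]
    exact ((hh.continuous 0).clm_apply hc1).const_smul (-Complex.I)
  · rw [hSW, hap]
    exact hd t

/-! ### The propagator -/

/-- An isometry with a right inverse is unitary. -/
theorem mem_unitary_of_norm_map [CompleteSpace ℋ] {U V : ℋ →L[ℂ] ℋ} (hU : ∀ x, ‖U x‖ = ‖x‖)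
    (hUV : U * V = 1) : U ∈ unitary (ℋ →L[ℂ] ℋ) := by
  have h1 : star U * U = 1 := U.norm_map_iff_adjoint_comp_self.1 hU
  have h2 : star U = V := by
    calc star U = star U * (U * V) := by rw [hUV, mul_one]
      _ = V := by rw [← mul_assoc, h1, one_mul]
  exact Unitary.mem_iff.2 ⟨h1, by rw [h2, hUV]⟩

theorem exists_isUnitaryPropagator [CompleteSpace ℋ] (hh : IsScaleGenerator S h M c)
    (hS : IsResolvent H₀ S) (hB : ∀ t, IsSelfAdjoint (B t)) (hdom : ∀ t, (B t).domain = H₀.domain)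
    (hap : ∀ t x, ap (B t) (S x) = h 0 t x) :
    ∃ U : ℝ → ℝ → unitary (ℋ →L[ℂ] ℋ), IsUnitaryPropagator U ∧ SolvesSchrodinger H₀ B U := by
  choose W hW using fun s => hh.exists_isScaleEvolution s
  have hsol : ∀ s x, IsSolution H₀ B s (S x) (fun t => W s 0 t (S x)) := fun s x =>
    (hW s).isSolution hh hS hdom hap x
  have hext : ∀ {U V : ℋ →L[ℂ] ℋ}, (∀ x, U (S x) = V (S x)) → U = V := fun {U V} hUV => by
    have := hh.denseRange.equalizer U.continuous V.continuous (funext hUV)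
    exact DFunLike.coe_injective this
  have hone : ∀ t, W t 0 t = 1 := fun t => (hW t).initial 0
  -- The cocycle property follows from uniqueness of solutions.
  have hcomp : ∀ t s r, W r 0 t = W s 0 t * W r 0 s := fun t s r => hext fun x => by
    have h1 := (hsol r x).restart s
    simp only [← (hW r).intertwine 0 s x] at h1
    have h2 := congrFun (h1.eq (hsol s (W r 1 s x)) hB) t
    rw [mul_apply_eq_comp, ← (hW r).intertwine 0 s x]
    exact h2
  have hnorm : ∀ s t x, ‖W s 0 t x‖ = ‖x‖ := fun s t x => by
    have h1 : ∀ s t x, ‖W s 0 t x‖ ≤ ‖x‖ := fun s t x => by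
      refine hh.denseRange.induction_on (p := fun x => ‖W s 0 t x‖ ≤ ‖x‖) x
        (isClosed_le (W s 0 t).continuous.norm continuous_norm) fun y => ?_
      exact (hsol s y).norm_le hB t
    refine le_antisymm (h1 s t x) ?_
    calc ‖x‖ = ‖W t 0 s (W s 0 t x)‖ := by
          rw [← mul_apply_eq_comp, ← hcomp, hone, one_apply_eq_self]
      _ ≤ _ := h1 t s _
  let U : ℝ → ℝ → unitary (ℋ →L[ℂ] ℋ) := fun t s => ⟨W s 0 t,
    mem_unitary_of_norm_map (hnorm s t) (V := W t 0 s) (by rw [← hcomp, hone])⟩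
  -- For isometries, strong continuity passes to the inverses `U(s, 0)⁻¹ = U(0, s)`.
  have hback : ∀ x, Continuous fun s => W s 0 0 x := fun x => by
    rw [continuous_iff_continuousAt]
    intro s₀
    rw [ContinuousAt, tendsto_iff_norm_sub_tendsto_zero]
    have h1 : ∀ s, ‖W s 0 0 x - W s₀ 0 0 x‖ = ‖x - W 0 0 s (W s₀ 0 0 x)‖ := fun s => by
      rw [← hnorm 0 s, map_sub, ← mul_apply_eq_comp, ← hcomp, hone, one_apply_eq_self]
    simp only [h1]
    have h2 := ((continuous_const (y := x)).sub ((hW 0).continuous 0 (W s₀ 0 0 x))).norm.tendsto s₀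
    simp only [Pi.sub_apply] at h2
    rwa [← mul_apply_eq_comp, ← hcomp, hone, one_apply_eq_self, sub_self, norm_zero] at h2
  refine ⟨U, ⟨fun t => Subtype.ext (hone t), fun t s r => Subtype.ext (hcomp t s r), fun x => ?_⟩,
    fun s ψ₀ hψ₀ => ?_⟩
  · change Continuous fun p : ℝ × ℝ => W p.2 0 p.1 x
    rw [continuous_iff_continuousAt]
    rintro ⟨t₀, s₀⟩
    rw [ContinuousAt, tendsto_iff_norm_sub_tendsto_zero]
    have h1 : Tendsto (fun p : ℝ × ℝ => ‖W p.2 0 0 x - W s₀ 0 0 x‖ +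
        ‖W 0 0 p.1 (W s₀ 0 0 x) - W 0 0 t₀ (W s₀ 0 0 x)‖) (𝓝 (t₀, s₀)) (𝓝 (0 + 0)) := by
      refine Tendsto.add ?_ ?_
      · exact (tendsto_iff_norm_sub_tendsto_zero.1 ((hback x).tendsto s₀)).comp
          (continuous_snd.tendsto (t₀, s₀))
      · exact (tendsto_iff_norm_sub_tendsto_zero.1
          (((hW 0).continuous 0 (W s₀ 0 0 x)).tendsto t₀)).comp (continuous_fst.tendsto (t₀, s₀))
    rw [add_zero] at h1
    refine squeeze_zero (fun _ => norm_nonneg _) (fun p => ?_) h1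
    dsimp only
    rw [hcomp p.1 0 p.2, hcomp t₀ 0 s₀, mul_apply_eq_comp, mul_apply_eq_comp,
      ← hnorm 0 p.1 (W p.2 0 0 x - W s₀ 0 0 x), map_sub]
    exact norm_sub_le_norm_sub_add_norm_sub _ _ _
  · obtain ⟨x, rfl⟩ := (hS.mem_domain_iff ψ₀).1 hψ₀
    exact ⟨hsol s x, fun φ hφ => hφ.eq (hsol s x) hB⟩

theorem SolvesSchrodinger.unique [CompleteSpace ℋ] {U V : ℝ → ℝ → unitary (ℋ →L[ℂ] ℋ)}
    (hU : SolvesSchrodinger H₀ B U) (hV : SolvesSchrodinger H₀ B V)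
    (hd : Dense (H₀.domain : Set ℋ)) : V = U := by
  funext t s
  refine Subtype.ext (DFunLike.coe_injective (Continuous.ext_on hd
    (ContinuousLinearMap.continuous _) (ContinuousLinearMap.continuous _) fun ψ hψ => ?_))
  exact congrFun ((hU s ψ hψ).2 _ (hV s ψ hψ).1) t

end Propagator

/-! ### The rescaled dynamics -/

section Rescaled
variable {ℋ : Type*} [NormedAddCommGroup ℋ] [InnerProductSpace ℂ ℋ] {H₀ : ℋ →ₗ.[ℂ] ℋ}
  {H : ℝ → (ℋ →ₗ.[ℂ] ℋ)} {S : ℋ →L[ℂ] ℋ} {h : ℕ → ℝ → (ℋ →L[ℂ] ℋ)} {M c : ℕ → ℝ}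

/-- Rescaling time does not change the bounds, which is the source of the uniformity in `T`. -/
theorem IsScaleGenerator.rescale (hh : IsScaleGenerator S h M c) (T : ℝ) :
    IsScaleGenerator S (fun m t => h m (t / T)) M c where
  isPositive := hh.isPositive
  injective := hh.injective
  intertwine m t := hh.intertwine m (t / T)
  symm t := hh.symm (t / T)
  continuous m := (hh.continuous m).comp (continuous_id.div_const T)
  norm_le m t := hh.norm_le m (t / T)
  nonneg := hh.nonneg
  norm_sub_le m t := hh.norm_sub_le m (t / T)

/-- By uniqueness, any family that solves the Schrödinger equation is the one built on the scale,
and inherits its regularity and bounds. -/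
theorem HamiltonianAssumptions.generalAssumptions [CompleteSpace ℋ]
    (hH : HamiltonianAssumptions H₀ H) {U : ℝ → ℝ → ℝ → unitary (ℋ →L[ℂ] ℋ)}
    (hU : ∀ T : ℝ, 0 < T → SolvesSchrodinger H₀ (rescale H T) (U T)) :
    GeneralAssumptions H₀ H (fun T t => U T t 0) := by
  obtain ⟨S, hS⟩ := exists_isResolvent hH.selfAdjoint₀ hH.positive₀
  obtain ⟨h, M, c, hh, hap⟩ := hH.exists_isScaleGenerator hS
  have hap0 : ∀ t x, ap (H t) (S x) = h 0 t x := fun t x => by simpa using hap 0 t x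
  choose W hW using fun T : ℝ => (hh.rescale T).exists_isScaleEvolution 0
  have hUW : ∀ T > 0, ∀ t, (U T t 0 : ℋ →L[ℂ] ℋ) = W T 0 t := fun T hT t => by
    refine DFunLike.coe_injective (hh.denseRange.equalizer (ContinuousLinearMap.continuous _)
      (ContinuousLinearMap.continuous _) (funext fun x => ?_))
    have h1 := (hW T).isSolution (B := ConstDom.rescale H T) (hh.rescale T) hS
      (fun t => hH.domain_eq (t / T)) (fun t x => hap0 (t / T) x) x
    exact (congrFun ((hU T hT 0 _ (hS.mem x)).2 _ h1) t).symm
  have hdom : ∀ m t ψ, ψ ∈ (ppow H₀ (m + 1)).domain →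
      ψ ∈ (pcomp (ppow H₀ m) (H t)).domain := fun m t ψ hψ => (hH.bound m).1 t hψ
  have hmem : ∀ {ψ}, ψ ∈ cinfty H₀ → ∀ m, ψ ∈ (ppow H₀ m).domain := fun {ψ} hψ m => by
    rw [cinfty, Submodule.mem_iInf] at hψ
    exact hψ m
  obtain ⟨H', -, hdiff⟩ := hH.diff
  refine
    { selfAdjoint₀ := hH.selfAdjoint₀
      U_zero := fun T hT => Subtype.ext ((hUW T hT 0).trans ((hW T).initial 0))
      H_cinfty := fun t ψ hψ => ?_
      U_cinfty := fun T hT t ψ hψ => ?_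
      H_cont := fun m ψ hψ => continuous_iff_continuousAt.2 fun t =>
        ((hdiff m ψ (hmem hψ _)).1 t).continuousAt
      U_diff := fun m T hT ψ hψ t => ?_
      H_bound := fun m r d => ?_
      U_bound := fun m _ r d => ?_
      H_periodic := fun t ψ _ => by rw [hH.periodic]
      band := ?_
      conj := hH.conj }
  · have h1 : ψ ∈ (H t).domain := ((mem_pcomp_iff _ _ _).1 (hdom 0 t ψ (hmem hψ 1))).1
    refine ⟨h1, ?_⟩
    rw [cinfty, Submodule.mem_iInf, ← ap_of_mem _ h1]
    exact fun m => ((mem_pcomp_iff _ _ _).1 (hdom m t ψ (hmem hψ _))).2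
  · rw [hS.mem_cinfty_iff] at hψ ⊢
    intro m
    obtain ⟨x, rfl⟩ := hψ m
    rw [hUW T hT]
    exact ⟨_, ((hW T).intertwine_pow m t x).symm⟩
  · obtain ⟨x, rfl⟩ := (hS.mem_cinfty_iff ψ).1 hψ (m + 1)
    have h1 : ∀ r, ap (ppow H₀ m) ((U T r 0 : ℋ →L[ℂ] ℋ) ((S ^ (m + 1)) x)) =
        ((1 - S) ^ m) (W T m r (S x)) := fun r => by
      rw [hUW T hT, pow_succ, mul_apply_eq_comp, (hW T).intertwine_pow, (hS.ppow_pow m _).2]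
    have h2 : ap (pcomp (ppow H₀ m) (ConstDom.rescale H T t))
        ((U T t 0 : ℋ →L[ℂ] ℋ) ((S ^ (m + 1)) x)) =
        ((1 - S) ^ m) (h m (t / T) (W T (m + 1) t x)) := by
      rw [hUW T hT, (hW T).intertwine_pow, ConstDom.rescale,
        ap_pcomp (hdom m _ _ (hS.ppow_pow (m + 1) _).1), hap, (hS.ppow_pow m _).2]
    simp only [h1]
    rw [h2, ← map_smul]
    exact (((1 - S) ^ m).restrictScalars ℝ).hasFDerivAt.comp_hasDerivAt t ((hW T).hasDerivAt m t x)
  · obtain ⟨a, b, ha, hb, hab⟩ := (hH.bound m).2 r d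
    exact ⟨1, a, b, ha, hb, fun t ht ψ hψ => hab t ht ψ (hmem hψ _)⟩
  · obtain ⟨C, hC0, hC⟩ := hS.exists_norm_le m
    set K : ℝ := ‖(1 - S) ^ m‖ * (Real.exp (c m * max |r| |d|) * C) with hK
    refine ⟨0, fun _ => K, fun _ => K, fun T hT => ⟨by positivity, by positivity,
      fun t ht ψ hψ => ?_⟩, Asymptotics.isBigO_const_const _ one_ne_zero _,
      Asymptotics.isBigO_const_const _ one_ne_zero _⟩
    obtain ⟨x, rfl⟩ := (hS.mem_cinfty_iff ψ).1 hψ m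
    rw [hUW T hT, (hW T).intertwine_pow, (hS.ppow_pow m _).2, ← mul_add, hK]
    refine (ContinuousLinearMap.le_opNorm _ _).trans ?_
    rw [mul_assoc, mul_assoc]
    gcongr
    refine ((hW T).norm_apply_le m t x).trans ?_
    have := hh.nonneg m
    rw [sub_zero]
    gcongr
    exacts [abs_le_max_abs_abs ht.1 ht.2, hC x]
  · obtain ⟨K, hK, α, β, h1, h2, E₀, h3, h4⟩ := hH.band
    exact ⟨K + 1, by linarith, α, β, h1, h2, E₀, h3, fun i j hij => h4 i j (by linarith)⟩

end Rescaled

end ConstDom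

theorem mainTheorem5 {ℋ : Type*} [NormedAddCommGroup ℋ] [InnerProductSpace ℂ ℋ] [CompleteSpace ℋ]
    (H₀ : ℋ →ₗ.[ℂ] ℋ) (H : ℝ → (ℋ →ₗ.[ℂ] ℋ)) (hH : ConstDom.HamiltonianAssumptions H₀ H) :
    (∀ T : ℝ, 0 < T → ∃ U : ℝ → ℝ → unitary (ℋ →L[ℂ] ℋ),
      ConstDom.IsUnitaryPropagator U ∧
      ConstDom.SolvesSchrodinger H₀ (ConstDom.rescale H T) U ∧
      ∀ V : ℝ → ℝ → unitary (ℋ →L[ℂ] ℋ),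
        ConstDom.SolvesSchrodinger H₀ (ConstDom.rescale H T) V → V = U) ∧
    ∀ U : ℝ → ℝ → ℝ → unitary (ℋ →L[ℂ] ℋ),
      (∀ T : ℝ, 0 < T → ConstDom.SolvesSchrodinger H₀ (ConstDom.rescale H T) (U T)) →
      ConstDom.GeneralAssumptions H₀ H (fun T t => U T t 0) := by
  refine ⟨fun T _ => ?_, fun U hU => hH.generalAssumptions hU⟩
  obtain ⟨S, hS⟩ := ConstDom.exists_isResolvent hH.selfAdjoint₀ hH.positive₀
  obtain ⟨h, M, c, hh, hap⟩ := hH.exists_isScaleGenerator hS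
  obtain ⟨U, hU1, hU2⟩ := ConstDom.exists_isUnitaryPropagator (B := ConstDom.rescale H T)
    (hh.rescale T) hS (fun t => hH.selfAdjoint (t / T)) (fun t => hH.domain_eq (t / T))
    (fun t x => by simpa [ConstDom.rescale] using hap 0 (t / T) x)
  exact ⟨U, hU1, hU2, fun V hV => hU2.unique hV hH.selfAdjoint₀.dense_domain⟩
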